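/- Let $\Omega=\mathbb C\smallsetminus\big((-\infty,0]\cup[1,+\infty)\big)$, let $\log$ be the principal branch of the logarithm, and for $z\in\mathbb C\smallsetminus[1,+\infty)$ let $\operatorname{Li}_2(z)=-\int_0^z\log(1-u)\,\frac{du}{u}$, the integral being along the segment from $0$ to $z$. For $z\in\Omega$ put $$g(z)=\Bigl(\tfrac12\log^2(1-z)-\tfrac{\pi^2}{6}+\operatorname{Li}_2(1-z)\Bigr)\frac1z ,\qquad J(t)=\int_0^1 g(x)e^{ixt}\,dx\quad(t\in\mathbb R).$$ Let $H_n=\sum_{k=1}^n\frac1k$, let $\gamma$ be Euler's constant, $\Psi=\Gamma'/\Gamma$ the digamma function, and for $n\ge0$ let $$A_n=\frac{H_{n+1}}{n+1}-\frac{2}{(n+1)^2},\quad B_n=\frac1{n+1},\quad C_n=-\Psi'(n+1),\quad D_n=\frac12 .$$ Then $g$ is integrable on $(0,1)$, and these numbers are the coefficients of the local expansions of $g$ at $0$ and $1$: $$g(z)=\sum_{n\ge0}A_nz^n+\Bigl(\sum_{n\ge0}B_nz^n\Bigr)\log z\qquad(z\in\Omega,\ |z|<1),$$ $$g(z)=\sum_{n\ge0}C_n(1-z)^n+\Bigl(\sum_{n\ge0}D_n(1-z)^n\Bigr)\log^2(1-z)\qquad(z\in\Omega,\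 |1-z|<1),$$ all four series being convergent there. Moreover, as $t\to+\infty$, $J$ has the full asymptotic expansion $$\begin{aligned}J(t)\sim{}&\sum_{n=0}^\infty i^{n+1}A_n\frac{n!}{t^{n+1}}+\sum_{n=0}^\infty i^{n+1}B_n\Bigl(\Psi(n+1)-\log t+\frac{\pi i}2\Bigr)\frac{n!}{t^{n+1}}\\&-ie^{it}\sum_{n=0}^\infty(-i)^nC_n\frac{n!}{t^{n+1}}-ie^{it}\sum_{n=0}^\infty(-i)^nD_n\Bigl\{\Psi'(n+1)+\Bigl(\gamma-H_n+\log t+\frac{\pi i}2\Bigr)^2\Bigr\}\frac{n!}{t^{n+1}},\end{aligned}$$ in the sense that for every integer $N\ge0$ the difference between $J(t)$ and the sum of the terms of the four series with $n<N$ is $O\bigl(t^{-N-1}\log^2t\bigr)$ as $t\to+\infty$. -/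

import Mathlib

open Filter Asymptotics MeasureTheory

noncomputable section

namespace LogFourier

/-- The complex plane with the two cuts `(-∞, 0]` and `[1, +∞)` removed. -/
def Omega : Set ℂ := {z | ¬ (z.im = 0 ∧ (z.re ≤ 0 ∨ 1 ≤ z.re))}

/-- The dilogarithm `Li₂(z) = -∫₀ᶻ log(1-u) du/u` on `ℂ ∖ [1, ∞)`, the path of integration being
the segment `u = s z`, `0 ≤ s ≤ 1` (so that `du/u = ds/s`). -/
def Li2 (z : ℂ) : ℂ := -∫ s in (0 : ℝ)..1, Complex.log (1 - (s : ℂ) * z) / (s : ℂ)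

/-- `g(z) = (½ log²(1-z) - π²/6 + Li₂(1-z)) / z`. -/
def g (z : ℂ) : ℂ :=
  (1 / 2 * Complex.log (1 - z) ^ 2 - (Real.pi : ℂ) ^ 2 / 6 + Li2 (1 - z)) * (1 / z)

/-- `J(t) = ∫₀¹ g(x) e^{ixt} dx`. -/
def J (t : ℝ) : ℂ := ∫ x in (0 : ℝ)..1, g (x : ℂ) * Complex.exp (Complex.I * (x : ℂ) * (t : ℂ))

/-- `A_n = H_{n+1}/(n+1) - 2/(n+1)²`. -/
def A (n : ℕ) : ℂ := ((harmonic (n + 1) : ℚ) : ℂ) / ((n : ℂ) + 1) - 2 / ((n : ℂ) + 1) ^ 2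

/-- `B_n = 1/(n+1)`. -/
def B (n : ℕ) : ℂ := 1 / ((n : ℂ) + 1)

/-- `C_n = -Ψ'(n+1)`, where `Ψ = Γ'/Γ` is the digamma function. -/
def C (n : ℕ) : ℂ := -deriv Complex.digamma ((n : ℂ) + 1)

/-- `D_n = 1/2`. -/
def D (_n : ℕ) : ℂ := 1 / 2

/-- The contribution of index `n` to the four series of the expansion of `J(t)`. -/
def expansionTerm (n : ℕ) (t : ℝ) : ℂ :=
  Complex.I ^ (n + 1) * A n * ((n.factorial : ℂ) / (t : ℂ) ^ (n + 1))
  + Complex.I ^ (n + 1) * B n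
      * (Complex.digamma ((n : ℂ) + 1) - (Real.log t : ℂ) + (Real.pi : ℂ) * Complex.I / 2)
      * ((n.factorial : ℂ) / (t : ℂ) ^ (n + 1))
  - Complex.I * Complex.exp (Complex.I * (t : ℂ))
      * ((-Complex.I) ^ n * C n * ((n.factorial : ℂ) / (t : ℂ) ^ (n + 1)))
  - Complex.I * Complex.exp (Complex.I * (t : ℂ))
      * ((-Complex.I) ^ n * D n
          * (deriv Complex.digamma ((n : ℂ) + 1)
              + ((Real.eulerMascheroniConstant : ℂ) - ((harmonic n : ℚ) : ℂ)
                  + (Real.log t : ℂ) + (Real.pi : ℂ) * Complex.I / 2) ^ 2)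
          * ((n.factorial : ℂ) / (t : ℂ) ^ (n + 1)))

end LogFourier

end

namespace LogFourier

/-! For `t > 0` the factor `exp(izt)` decays upwards, so the segment `[0,1]` is pushed to the other
three sides of the rectangle with corners `0`, `1`, `1 + i/2`, `i/2` (`J_eq_of_integrable`). The top
side is `O(exp(-t/2))`. On the vertical sides `z = iy` and `z = 1 + iy` the exponential becomes
`exp(-ty)`, up to the factor `exp(it)` on the right. Inserting the local expansions of `g` leaves
Laplace integrals of power series times powers of `log y + c`, with `c` equal to `0` or `±πi/2`. A
Watson lemma with logarithms (`watson`) lets these be expanded termwise.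

The model integrals of `y^n (log y + c)^k exp(-ty)` are exact: scaling reduces them to Mellin
transforms of `log^j x · exp(-x)` at `n + 1`, which are derivatives of `Γ` and bring in `Ψ` and
`Ψ'`.

The expansion of `g` at `1` is read off from its definition. The one at `0` needs Euler's reflection
formula `Li2_reflection`, which trades `Li2 (1 - z)` for `Li2 z` and a product of logarithms.
Identifying `C_n` requires `Ψ'(1) = π²/6`, obtained from the reflection formula of `Γ`. -/

open Complex Set Topology

/-! ### Mellin transforms of `log^j x · exp(-x)` and derivatives of `Γ` -/

/-- The weight `x ↦ log(x)^j e^{-x}`. -/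
noncomputable def logExp (j : ℕ) (x : ℝ) : ℂ := (Real.log x : ℂ) ^ j * (Real.exp (-x) : ℂ)

theorem logExp_succ (j : ℕ) : logExp (j + 1) = fun x => Real.log x • logExp j x := by
  funext x
  simp only [logExp, real_smul]
  ring

theorem logExp_isBigO_atTop (j : ℕ) (a : ℝ) : logExp j =O[atTop] (fun x : ℝ => x ^ (-a)) := by
  induction j generalizing a with
  | zero =>
    have h := (isLittleO_exp_neg_mul_rpow_atTop (zero_lt_one (α := ℝ)) (-a)).isBigO
    refine (IsBigO.congr_left (h.norm_left) (fun x => ?_) |>.of_norm_left)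
    · simp [logExp, norm_exp]
  | succ j ih =>
    rw [logExp_succ]
    exact isBigO_rpow_top_log_smul (lt_add_one a) (ih (a + 1))

/-- A logarithm costs an arbitrarily small power of `x`; halving `b` at each induction step leaves
room for it. -/
theorem logExp_isBigO_zero (j : ℕ) {b : ℝ} (hb : 0 < b) :
    logExp j =O[𝓝[>] 0] (fun x : ℝ => x ^ (-b)) := by
  induction j generalizing b with
  | zero =>
    have h1 : logExp 0 =O[𝓝[>] 0] (fun _ : ℝ => (1 : ℝ)) := by
      have hc : Continuous (logExp 0) := by
        unfold logExp
        simp only [pow_zero, one_mul]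
        fun_prop
      exact (hc.continuousAt (x := 0)).continuousWithinAt.isBigO_one ℝ
    refine h1.trans (IsBigO.of_bound 1 ?_)
    filter_upwards [Ioo_mem_nhdsGT (zero_lt_one (α := ℝ))] with x hx
    have : 1 ≤ x ^ (-b) := Real.one_le_rpow_of_pos_of_le_one_of_nonpos hx.1 hx.2.le (by linarith)
    rw [norm_one, one_mul]
    exact this.trans (Real.le_norm_self _)
  | succ j ih =>
    rw [logExp_succ]
    exact isBigO_rpow_zero_log_smul (half_lt_self hb) (ih (half_pos hb))

theorem logExp_continuousOn (j : ℕ) : ContinuousOn (logExp j) (Ioi 0) := by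
  intro x hx
  have : ContinuousAt Real.log x := Real.continuousAt_log (ne_of_gt hx)
  unfold logExp
  exact (by fun_prop : ContinuousAt _ x).continuousWithinAt

/-- Differentiating `x^(s-1)` in `s` inserts a factor `log x`. Starting from `Γ`, this yields every
log moment as a derivative. -/
theorem mellin_logExp (j : ℕ) {s : ℂ} (hs : 0 < s.re) :
    MellinConvergent (logExp (j + 1)) s ∧
      HasDerivAt (mellin (logExp j)) (mellin (logExp (j + 1)) s) s := by
  rw [logExp_succ]
  exact mellin_hasDerivAt_of_isBigO_rpow
    ((logExp_continuousOn j).locallyIntegrableOn measurableSet_Ioi)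
    (logExp_isBigO_atTop j (s.re + 1)) (lt_add_one _)
    (logExp_isBigO_zero j (half_pos hs)) (half_lt_self hs)

theorem mellinConvergent_logExp (j : ℕ) {s : ℂ} (hs : 0 < s.re) :
    MellinConvergent (logExp j) s :=
  mellinConvergent_of_isBigO_rpow ((logExp_continuousOn j).locallyIntegrableOn measurableSet_Ioi)
    (logExp_isBigO_atTop j (s.re + 1)) (lt_add_one _)
    (logExp_isBigO_zero j (half_pos hs)) (half_lt_self hs)

theorem isOpen_re_pos : IsOpen {s : ℂ | 0 < s.re} := isOpen_lt continuous_const continuous_re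

theorem ne_neg_nat_of_re_pos {s : ℂ} (hs : 0 < s.re) (m : ℕ) : s ≠ -m := by
  rintro rfl
  have : (0 : ℝ) ≤ m := m.cast_nonneg
  simp at hs
  linarith

theorem Gamma_hasDerivAt {s : ℂ} (hs : 0 < s.re) :
    HasDerivAt Gamma (Gamma s * digamma s) s := by
  have h := (differentiableAt_Gamma s (ne_neg_nat_of_re_pos hs)).hasDerivAt
  rwa [digamma_def, logDeriv_apply, mul_div_cancel₀ _ (Gamma_ne_zero (ne_neg_nat_of_re_pos hs))]

theorem digamma_hasDerivAt {s : ℂ} (hs : 0 < s.re) :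
    HasDerivAt digamma (deriv digamma s) s := by
  have hG : DifferentiableOn ℂ Gamma {s : ℂ | 0 < s.re} := fun z hz =>
    (Gamma_hasDerivAt hz).differentiableAt.differentiableWithinAt
  have h1 : DifferentiableAt ℂ (deriv Gamma) s :=
    (hG.deriv isOpen_re_pos).differentiableAt (isOpen_re_pos.mem_nhds hs)
  have h2 : DifferentiableAt ℂ digamma s := by
    have : digamma = fun z => deriv Gamma z / Gamma z := by
      funext z
      rw [digamma_def, logDeriv_apply]
    rw [this]
    exact h1.div (Gamma_hasDerivAt hs).differentiableAt (Gamma_ne_zero (ne_neg_nat_of_re_pos hs))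
  exact h2.hasDerivAt

theorem mellin_logExp_zero {s : ℂ} (hs : 0 < s.re) : mellin (logExp 0) s = Gamma s := by
  rw [Gamma_eq_integral hs, GammaIntegral_eq_mellin]
  congr 1
  funext x
  simp [logExp]

theorem mellin_logExp_one {s : ℂ} (hs : 0 < s.re) :
    mellin (logExp 1) s = Gamma s * digamma s := by
  refine (mellin_logExp 0 hs).2.unique ((Gamma_hasDerivAt hs).congr_of_eventuallyEq ?_)
  filter_upwards [isOpen_re_pos.mem_nhds hs] with z hz using mellin_logExp_zero hz

theorem mellin_logExp_two {s : ℂ} (hs : 0 < s.re) :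
    mellin (logExp 2) s = Gamma s * (deriv digamma s + digamma s ^ 2) := by
  have h := ((Gamma_hasDerivAt hs).mul (digamma_hasDerivAt hs)).congr_of_eventuallyEq
    (f₁ := mellin (logExp 1)) (by
      filter_upwards [isOpen_re_pos.mem_nhds hs] with z hz using mellin_logExp_one hz)
  rw [(mellin_logExp 1 hs).2.unique h]
  ring

/-! ### Values of `Ψ` and `Ψ'` at positive integers -/

theorem digamma_nat_add_one (n : ℕ) :
    digamma ((n : ℂ) + 1) = ((harmonic n : ℚ) : ℂ) - (Real.eulerMascheroniConstant : ℂ) := by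
  rw [digamma_def, logDeriv_apply, deriv_Gamma_nat, Gamma_nat_eq_factorial,
    mul_div_cancel_left₀ _ (by exact_mod_cast n.factorial_ne_zero)]
  ring

theorem deriv_digamma_add_one {s : ℂ} (hs : 0 < s.re) :
    deriv digamma (s + 1) = deriv digamma s - 1 / s ^ 2 := by
  have hs0 : s ≠ 0 := by simpa using ne_neg_nat_of_re_pos hs 0
  have h1 : HasDerivAt (fun z => digamma (z + 1)) (deriv digamma (s + 1)) s :=
    (digamma_hasDerivAt (s := s + 1) (by simp; linarith)).comp_add_const s 1
  have h2 : HasDerivAt (fun z => digamma z + z⁻¹) (deriv digamma s + -(s ^ 2)⁻¹) s :=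
    (digamma_hasDerivAt hs).add (hasDerivAt_inv hs0)
  rw [h1.unique (h2.congr_of_eventuallyEq ?_)]
  · ring
  · filter_upwards [isOpen_re_pos.mem_nhds hs] with z hz using
      digamma_apply_add_one z (ne_neg_nat_of_re_pos hz)

theorem tendsto_sin_sub_mul_cos_div_cube :
    Tendsto (fun x : ℝ => (Real.sin (Real.pi * x) - Real.pi * x * Real.cos (Real.pi * x)) / x ^ 3)
      (𝓝[≠] 0) (𝓝 (Real.pi ^ 3 / 3)) := by
  have hnum (x : ℝ) : HasDerivAt
      (fun x : ℝ => Real.sin (Real.pi * x) - Real.pi * x * Real.cos (Real.pi * x))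
      (Real.pi ^ 2 * x * Real.sin (Real.pi * x)) x := by
    have h0 : HasDerivAt (fun x : ℝ => Real.pi * x) Real.pi x := by
      simpa using (hasDerivAt_id x).const_mul Real.pi
    exact (h0.sin.sub (h0.mul h0.cos)).congr_deriv (by ring)
  have hden (x : ℝ) : HasDerivAt (fun x : ℝ => x ^ 3) (3 * x ^ 2) x := by
    simpa using hasDerivAt_pow 3 x
  have hsin : Tendsto (fun x : ℝ => Real.sin (Real.pi * x) / x) (𝓝[≠] 0) (𝓝 Real.pi) := by
    have h0 : HasDerivAt (fun x : ℝ => Real.sin (Real.pi * x)) Real.pi 0 := by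
      simpa using ((hasDerivAt_id (0 : ℝ)).const_mul Real.pi).sin
    refine (hasDerivAt_iff_tendsto_slope.1 h0).congr fun x => ?_
    simp [slope_def_field]
  refine HasDerivAt.lhopital_zero_nhdsNE (Eventually.of_forall hnum) (Eventually.of_forall hden)
    ?_ ?_ ?_ ?_
  · filter_upwards [self_mem_nhdsWithin] with x hx
    have : x ≠ 0 := hx
    positivity
  · exact ((by fun_prop : Continuous fun x : ℝ =>
      Real.sin (Real.pi * x) - Real.pi * x * Real.cos (Real.pi * x)).tendsto' 0 0
        (by simp)).mono_left nhdsWithin_le_nhds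
  · exact ((by fun_prop : Continuous fun x : ℝ => x ^ 3).tendsto' 0 0
        (by simp)).mono_left nhdsWithin_le_nhds
  · have := hsin.const_mul (Real.pi ^ 2 / 3)
    rw [show Real.pi ^ 3 / 3 = Real.pi ^ 2 / 3 * Real.pi by ring]
    refine this.congr' ?_
    filter_upwards [self_mem_nhdsWithin] with x hx
    have : x ≠ 0 := hx
    field_simp

/-- Differentiate `Γ(1+z) Γ(1-z) sin(πz) = πz` and eliminate the Gamma factors with the same
identity. The form without division also covers `x = 0`. -/
theorem digamma_reflection_mul {x : ℂ} (hx : ‖x‖ < 1) :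
    x * (digamma (1 + x) - digamma (1 - x)) * sin (Real.pi * x) =
      sin (Real.pi * x) - Real.pi * x * cos (Real.pi * x) := by
  have hre {z : ℂ} (hz : ‖z‖ < 1) : 0 < (1 + z).re ∧ 0 < (1 - z).re := by
    have := abs_le.1 (abs_re_le_norm z)
    constructor <;> simp <;> linarith
  have hpi : (Real.pi : ℂ) ≠ 0 := by exact_mod_cast Real.pi_ne_zero
  have key (z : ℂ) (hz : ‖z‖ < 1) :
      Gamma (1 + z) * Gamma (1 - z) * sin (Real.pi * z) = Real.pi * z := by
    by_cases h0 : z = 0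
    · simp [h0]
    have hsin : sin (Real.pi * z) ≠ 0 := by
      rw [Ne, sin_eq_zero_iff]
      rintro ⟨k, hk⟩
      have hzk : z = k := by
        apply mul_left_cancel₀ hpi
        rw [hk, mul_comm]
      rw [hzk, norm_intCast] at hz
      have : k = 0 := by
        rw [← Int.abs_lt_one_iff]
        exact_mod_cast hz
      exact h0 (by simp [hzk, this])
    rw [add_comm, Gamma_add_one z h0, mul_assoc z, Gamma_mul_Gamma_one_sub, mul_assoc,
      div_mul_cancel₀ _ hsin, mul_comm]
  have hd : HasDerivAt (fun z => Gamma (1 + z) * Gamma (1 - z) * sin (Real.pi * z))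
      (Real.pi : ℂ) x := by
    have h0 : HasDerivAt (fun z : ℂ => Real.pi * z) Real.pi x := by
      simpa using (hasDerivAt_id x).const_mul (Real.pi : ℂ)
    refine h0.congr_of_eventuallyEq ?_
    filter_upwards [(isOpen_lt continuous_norm continuous_const).mem_nhds hx] with z hz
        using key z hz
  have hp : HasDerivAt (fun z : ℂ => 1 + z) 1 x := (hasDerivAt_id x).const_add 1
  have hm : HasDerivAt (fun z : ℂ => 1 - z) (-1) x := by
    simpa using (hasDerivAt_id x).const_sub 1
  have hs : HasDerivAt (fun z : ℂ => sin (Real.pi * z)) (cos (Real.pi * x) * Real.pi) x := by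
    simpa using (((hasDerivAt_id x).const_mul (Real.pi : ℂ)).csin)
  have h2 := (((Gamma_hasDerivAt (hre hx).1).comp x hp).mul
    ((Gamma_hasDerivAt (hre hx).2).comp x hm)).mul hs
  have h3 := hd.unique h2
  simp only [Function.comp_apply, Pi.mul_apply] at h3
  have h4 := key x hx
  apply mul_left_cancel₀ hpi
  linear_combination (-sin (Real.pi * x)) * h3 - ((digamma (1 + x) - digamma (1 - x)) *
    sin (Real.pi * x) + cos (Real.pi * x) * Real.pi) * h4

/-- The odd combination `Ψ(1+x) - Ψ(1-x)` has slope `2Ψ'(1)` at `0`. Its difference quotient times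
that of `sin(πx)` equals `(sin πx - πx cos πx)/x³` by reflection, so `2π Ψ'(1) = π³/3`. -/
theorem deriv_digamma_one : deriv digamma 1 = (Real.pi : ℂ) ^ 2 / 6 := by
  have hpi : (Real.pi : ℂ) ≠ 0 := by exact_mod_cast Real.pi_ne_zero
  have hd : HasDerivAt (fun z : ℂ => digamma (1 + z) - digamma (1 - z)) (2 * deriv digamma 1) 0 := by
    have hp : HasDerivAt (fun z : ℂ => 1 + z) 1 0 := (hasDerivAt_id _).const_add 1
    have hm : HasDerivAt (fun z : ℂ => 1 - z) (-1) 0 := by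
      simpa using (hasDerivAt_id (0 : ℂ)).const_sub 1
    have h1 : HasDerivAt digamma (deriv digamma 1) (1 + 0) := by
      simpa using digamma_hasDerivAt (s := 1) (by simp)
    have h2 : HasDerivAt digamma (deriv digamma 1) (1 - 0) := by
      simpa using digamma_hasDerivAt (s := 1) (by simp)
    exact ((h1.comp 0 hp).sub (h2.comp 0 hm)).congr_deriv (by ring)
  have hs : HasDerivAt (fun z : ℂ => sin (Real.pi * z)) Real.pi 0 := by
    simpa using (((hasDerivAt_id (0 : ℂ)).const_mul (Real.pi : ℂ)).csin)
  have hlim := (hasDerivAt_iff_tendsto_slope.1 hd).mul (hasDerivAt_iff_tendsto_slope.1 hs)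
  have hcast : Tendsto (fun x : ℝ => (x : ℂ)) (𝓝[≠] 0) (𝓝[≠] 0) := by
    refine tendsto_nhdsWithin_iff.2 ⟨?_, ?_⟩
    · exact (continuous_ofReal.tendsto' 0 0 (by simp)).mono_left nhdsWithin_le_nhds
    · filter_upwards [self_mem_nhdsWithin] with x hx
      simpa using hx
  have hL := hlim.comp hcast
  have hR := (continuous_ofReal.tendsto (Real.pi ^ 3 / 3)).comp tendsto_sin_sub_mul_cos_div_cube
  have hEq := tendsto_nhds_unique (hL.congr' ?_) hR
  · have hEq' : 2 * deriv digamma 1 * (Real.pi : ℂ) = (Real.pi : ℂ) ^ 3 / 3 := by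
      rw [hEq]
      push_cast
      rfl
    apply mul_right_cancel₀ hpi
    linear_combination hEq' / 2
  · have hball : Metric.ball (0 : ℝ) 1 ∈ 𝓝[≠] (0 : ℝ) :=
      nhdsWithin_le_nhds (Metric.ball_mem_nhds 0 one_pos)
    filter_upwards [self_mem_nhdsWithin, hball] with x hx hx1
    have hx0 : (x : ℂ) ≠ 0 := by simpa using hx
    have hxn : ‖(x : ℂ)‖ < 1 := by simpa using hx1
    have := digamma_reflection_mul hxn
    simp only [Function.comp_apply, slope_def_field]
    push_cast
    rw [← this]
    simp only [add_zero, sub_zero, sub_self, mul_zero, sin_zero]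
    field_simp

theorem deriv_digamma_nat_add_one (n : ℕ) :
    deriv digamma ((n : ℂ) + 1) =
      (Real.pi : ℂ) ^ 2 / 6 - ∑ k ∈ Finset.range n, 1 / ((k : ℂ) + 1) ^ 2 := by
  induction n with
  | zero => simp [deriv_digamma_one]
  | succ n ih =>
    push_cast
    rw [deriv_digamma_add_one (s := (n : ℂ) + 1) (by simp; positivity), ih, Finset.sum_range_succ]
    ring

/-! ### The doubly cut plane -/

theorem Omega_eq : Omega = slitPlane ∩ {z | 1 - z ∈ slitPlane} := by
  ext z
  simp only [Omega, mem_inter_iff, mem_ofPred_eq, mem_slitPlane_iff, sub_re, one_re, sub_im, one_im]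
  constructor
  · intro h
    by_cases hz : z.im = 0
    · have : ¬ (z.re ≤ 0 ∨ 1 ≤ z.re) := fun h' => h ⟨hz, h'⟩
      push Not at this
      exact ⟨Or.inl this.1, Or.inl (by linarith)⟩
    · exact ⟨Or.inr hz, Or.inr (by simpa using hz)⟩
  · rintro ⟨h1, h2⟩ ⟨h3, h4⟩
    simp only [h3, ne_eq, not_true_eq_false, or_false, sub_zero] at h1 h2
    rcases h4 with h4 | h4 <;> linarith

theorem isOpen_one_sub_slitPlane : IsOpen {z : ℂ | 1 - z ∈ slitPlane} :=
  isOpen_slitPlane.preimage (continuous_const.sub continuous_id)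

theorem isOpen_Omega : IsOpen Omega := by
  rw [Omega_eq]
  exact isOpen_slitPlane.inter isOpen_one_sub_slitPlane

theorem ofReal_mem_Omega {x : ℝ} (hx : x ∈ Ioo (0 : ℝ) 1) : (x : ℂ) ∈ Omega := by
  simp only [Omega, mem_ofPred_eq, ofReal_im, ofReal_re, true_and]
  push Not
  exact hx

theorem mem_Omega_of_im_ne_zero {z : ℂ} (hz : z.im ≠ 0) : z ∈ Omega := fun h => hz h.1

theorem isPreconnected_Omega : IsPreconnected Omega := by
  have hmem : ((1 / 2 : ℝ) : ℂ) ∈ Omega := ofReal_mem_Omega (by norm_num)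
  have h1 : StarConvex ℝ ((1 / 2 : ℝ) : ℂ) slitPlane := starConvex_ofReal_slitPlane (by norm_num)
  -- The map `z ↦ 1 - z` is affine and fixes `1/2`, so it carries star-convexity about `1/2` from
  -- one cut plane to the other.
  have h2 : StarConvex ℝ ((1 / 2 : ℝ) : ℂ) {z | 1 - z ∈ slitPlane} := by
    intro y hy a b ha hb hab
    have := h1 hy ha hb hab
    change 1 - (a • ((1 / 2 : ℝ) : ℂ) + b • y) ∈ slitPlane
    convert this using 1
    have hab' : (a : ℂ) + b = 1 := by exact_mod_cast hab
    simp only [real_smul]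
    push_cast
    linear_combination (-1 : ℂ) * hab'
  rw [Omega_eq] at hmem ⊢
  exact ((h1.inter h2).isPathConnected hmem).isConnected.isPreconnected

/-! ### The dilogarithm: derivative, power series, reflection -/

theorem one_sub_mul_mem_slitPlane {z : ℂ} (hz : 1 - z ∈ slitPlane) {s : ℝ} (hs : s ∈ Icc (0 : ℝ) 1) :
    1 - (s : ℂ) * z ∈ slitPlane := by
  have := starConvex_one_slitPlane hz (sub_nonneg.2 hs.2) hs.1 (sub_add_cancel 1 s)
  convert this using 1
  simp only [real_smul]
  push_cast
  ring

theorem hasDerivAt_log_one_sub_mul {z : ℂ} {s : ℝ} (hs : 1 - (s : ℂ) * z ∈ slitPlane) :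
    HasDerivAt (fun s : ℝ => log (1 - (s : ℂ) * z)) (-z / (1 - (s : ℂ) * z)) s := by
  have h : HasDerivAt (fun s : ℝ => 1 - (s : ℂ) * z) (-z) s := by
    simpa using ((hasDerivAt_id s).ofReal_comp.mul_const z).const_sub 1
  exact h.clog_real hs

theorem intervalIntegrable_log_div {z : ℂ} (hz : 1 - z ∈ slitPlane) :
    IntervalIntegrable (fun s : ℝ => log (1 - (s : ℂ) * z) / (s : ℂ)) volume 0 1 := by
  set f : ℝ → ℂ := fun s => log (1 - (s : ℂ) * z) with hf
  have hd (s : ℝ) (hs : s ∈ Icc (0 : ℝ) 1) : DifferentiableAt ℝ f s :=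
    (hasDerivAt_log_one_sub_mul (one_sub_mul_mem_slitPlane hz hs)).differentiableAt
  -- The singularity at `s = 0` is removable: `f 0 = 0`, so the integrand is the difference quotient
  -- of `f` at `0`, which `dslope` extends continuously.
  have hc : ContinuousOn (dslope f 0) (Icc 0 1) := by
    intro x hx
    rcases eq_or_ne x 0 with rfl | hx0
    · exact (continuousAt_dslope_same.2 (hd 0 hx)).continuousWithinAt
    · exact ((continuousAt_dslope_of_ne hx0).2 (hd x hx).continuousAt).continuousWithinAt
  have hi : IntervalIntegrable (dslope f 0) volume 0 1 :=
    (hc.mono (by rw [uIcc_of_le zero_le_one])).intervalIntegrable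
  refine hi.congr fun s hs => ?_
  rw [uIoc_of_le zero_le_one] at hs
  rw [dslope_of_ne _ hs.1.ne', slope_def_module]
  simp [hf, real_smul, div_eq_inv_mul]

/-- Differentiating under the integral cancels the factor `1/s`; what remains has the primitive `log
(1 - s z) / z` in `s`. -/
theorem hasDerivAt_Li2 {z : ℂ} (hz : 1 - z ∈ slitPlane) (hz0 : z ≠ 0) :
    HasDerivAt Li2 (-log (1 - z) / z) z := by
  obtain ⟨r, hr, hball⟩ := Metric.isOpen_iff.1 isOpen_one_sub_slitPlane z hz
  have hK : Metric.closedBall z (r / 2) ⊆ {z | 1 - z ∈ slitPlane} :=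
    (Metric.closedBall_subset_ball (half_lt_self hr)).trans hball
  have hne (s : ℝ) (hs : s ∈ Icc (0 : ℝ) 1) (w : ℂ) (hw : w ∈ Metric.closedBall z (r / 2)) :
      1 - (s : ℂ) * w ≠ 0 := slitPlane_ne_zero (one_sub_mul_mem_slitPlane (hK hw) hs)
  obtain ⟨M, hM⟩ := ((isCompact_Icc (a := (0 : ℝ)) (b := 1)).prod
    (isCompact_closedBall z (r / 2))).exists_bound_of_continuousOn
      (f := fun p : ℝ × ℂ => -1 / (1 - (p.1 : ℂ) * p.2)) (by
        refine ContinuousOn.div (by fun_prop) (by fun_prop) fun p hp => hne p.1 hp.1 p.2 hp.2)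
  have huIoc (s : ℝ) (hs : s ∈ Set.uIoc (0 : ℝ) 1) : s ∈ Ioc (0 : ℝ) 1 := by
    rwa [uIoc_of_le zero_le_one] at hs
  have hnhds : ∀ᶠ w in 𝓝 z, 1 - w ∈ slitPlane := isOpen_one_sub_slitPlane.mem_nhds hz
  have h := intervalIntegral.hasDerivAt_integral_of_dominated_loc_of_deriv_le
    (F := fun (w : ℂ) (s : ℝ) => log (1 - (s : ℂ) * w) / (s : ℂ))
    (F' := fun (w : ℂ) (s : ℝ) => -1 / (1 - (s : ℂ) * w)) (μ := volume) (a := 0) (b := 1)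
    (bound := fun _ => M) (Metric.closedBall_mem_nhds z (half_pos hr))
    (hnhds.mono fun w hw => by
      have := (intervalIntegrable_log_div hw).aestronglyMeasurable
      rwa [uIoc_of_le zero_le_one])
    (intervalIntegrable_log_div hz)
    (by
      rw [uIoc_of_le zero_le_one]
      refine ContinuousOn.aestronglyMeasurable ?_ measurableSet_Ioc
      refine ContinuousOn.div (by fun_prop) (by fun_prop) fun s hs =>
        hne s (Ioc_subset_Icc_self hs) z (Metric.mem_closedBall_self (half_pos hr).le))
    (Eventually.of_forall fun s hs w hw => hM (s, w) ⟨Ioc_subset_Icc_self (huIoc s hs), hw⟩)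
    intervalIntegrable_const
    (Eventually.of_forall fun s hs w hw => by
      have hs0 : (s : ℂ) ≠ 0 := by exact_mod_cast (huIoc s hs).1.ne'
      have hmem := one_sub_mul_mem_slitPlane (hK hw) (Ioc_subset_Icc_self (huIoc s hs))
      have h1 : HasDerivAt (fun w : ℂ => 1 - (s : ℂ) * w) (-(s : ℂ)) w := by
        simpa using ((hasDerivAt_id w).const_mul (s : ℂ)).const_sub 1
      refine ((h1.clog hmem).div_const (s : ℂ)).congr_deriv ?_
      field_simp)
  refine h.2.neg.congr_deriv ?_
  have hftc : ∫ s in (0 : ℝ)..1, -1 / (1 - (s : ℂ) * z) = log (1 - z) / z := by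
    rw [intervalIntegral.integral_eq_sub_of_hasDerivAt
      (f := fun s : ℝ => log (1 - (s : ℂ) * z) / z) _ h.1]
    · simp
    · intro s hs
      rw [uIcc_of_le zero_le_one] at hs
      refine ((hasDerivAt_log_one_sub_mul (one_sub_mul_mem_slitPlane hz hs)).div_const z).congr_deriv
        ?_
      field_simp
  rw [hftc, neg_div]

theorem hasSum_Li2 {w : ℂ} (hw : ‖w‖ < 1) :
    HasSum (fun n : ℕ => w ^ (n + 1) / ((n : ℂ) + 1) ^ 2) (Li2 w) := by
  have hs := intervalIntegral.hasSum_integral_of_dominated_convergence (μ := volume)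
    (a := (0 : ℝ)) (b := 1)
    (F := fun (n : ℕ) (s : ℝ) => w ^ (n + 1) / ((n : ℂ) + 1) * (s : ℂ) ^ n)
    (f := fun s : ℝ => -(log (1 - (s : ℂ) * w) / (s : ℂ)))
    (fun n _ => ‖w‖ ^ n)
    (fun n => (by fun_prop : Continuous fun s : ℝ =>
      w ^ (n + 1) / ((n : ℂ) + 1) * (s : ℂ) ^ n).aestronglyMeasurable)
    (fun n => Eventually.of_forall fun s hs => by
      rw [uIoc_of_le zero_le_one] at hs
      have h1 : ‖(n : ℂ) + 1‖ = n + 1 := by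
        rw [← Nat.cast_add_one, norm_natCast]; push_cast; rfl
      have h2 : (1 : ℝ) ≤ n + 1 := by simp
      rw [norm_mul, norm_div, norm_pow, norm_pow, h1, norm_real, Real.norm_of_nonneg hs.1.le]
      calc ‖w‖ ^ (n + 1) / (n + 1) * s ^ n ≤ ‖w‖ ^ (n + 1) * 1 :=
            mul_le_mul (div_le_self (by positivity) h2) (pow_le_one₀ hs.1.le hs.2)
              (pow_nonneg hs.1.le _) (by positivity)
        _ ≤ ‖w‖ ^ n := by
          rw [mul_one]
          exact pow_le_pow_of_le_one (norm_nonneg _) hw.le n.le_succ)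
    (Eventually.of_forall fun s _ => summable_geometric_of_lt_one (norm_nonneg _) hw)
    intervalIntegrable_const
    (Eventually.of_forall fun s hs => by
      rw [uIoc_of_le zero_le_one] at hs
      have hs0 : (s : ℂ) ≠ 0 := by exact_mod_cast hs.1.ne'
      have hsw : ‖(s : ℂ) * w‖ < 1 := by
        rw [norm_mul, norm_real, Real.norm_of_nonneg hs.1.le]
        exact (mul_le_of_le_one_left (norm_nonneg _) hs.2).trans_lt hw
      have := (hasSum_taylorSeries_neg_log' hsw).div_const (s : ℂ)
      rw [neg_div] at this
      refine this.congr_fun ?_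
      intro n
      field_simp
      ring)
  have hval : ∫ s in (0 : ℝ)..1, -(log (1 - (s : ℂ) * w) / (s : ℂ)) = Li2 w := by
    rw [intervalIntegral.integral_neg, Li2]
  rw [hval] at hs
  refine hs.congr_fun fun n => ?_
  rw [intervalIntegral.integral_const_mul]
  have : ∫ s in (0 : ℝ)..1, (s : ℂ) ^ n = 1 / ((n : ℂ) + 1) := by
    have h := integral_pow (a := 0) (b := 1) n
    have h2 : ∫ s in (0 : ℝ)..1, (s : ℂ) ^ n = ((∫ s in (0 : ℝ)..1, s ^ n : ℝ) : ℂ) := by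
      rw [← intervalIntegral.integral_ofReal]
      push_cast
      rfl
    rw [h2, h]
    simp
  rw [this]
  field_simp

theorem hasSum_one_div_add_one_sq :
    HasSum (fun n : ℕ => 1 / ((n : ℂ) + 1) ^ 2) ((Real.pi : ℂ) ^ 2 / 6) := by
  have h := (hasSum_nat_add_iff' 1).2 hasSum_zeta_two
  have h2 := hasSum_ofReal.2 h
  push_cast at h2
  simpa using h2

/-- The left side has derivative zero on the connected set `Omega`. The constant is found by letting
`x → 0+` on the real segment. -/
theorem Li2_reflection {z : ℂ} (hz : z ∈ Omega) :
    Li2 z + Li2 (1 - z) + log z * log (1 - z) = (Real.pi : ℂ) ^ 2 / 6 := by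
  set F : ℂ → ℂ := fun z => Li2 z + Li2 (1 - z) + log z * log (1 - z) with hF
  have hd (w : ℂ) (hw : w ∈ Omega) : HasDerivAt F 0 w := by
    rw [Omega_eq] at hw
    obtain ⟨h1, h2⟩ := hw
    simp only [mem_ofPred_eq] at h2
    have hw0 := slitPlane_ne_zero h1
    have hw1 := slitPlane_ne_zero h2
    have hm : HasDerivAt (fun z : ℂ => 1 - z) (-1) w := by
      simpa using (hasDerivAt_id w).const_sub 1
    have hb : HasDerivAt (fun z => Li2 (1 - z)) (-log (1 - (1 - w)) / (1 - w) * -1) w :=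
      (hasDerivAt_Li2 (z := 1 - w) (by simpa using h1) hw1).comp w hm
    refine (((hasDerivAt_Li2 h2 hw0).add hb).add ((hasDerivAt_log h1).mul (hm.clog h2))).congr_deriv
      ?_
    rw [sub_sub_cancel]
    field_simp
    ring
  obtain ⟨a, ha⟩ := isOpen_Omega.exists_is_const_of_deriv_eq_zero isPreconnected_Omega
    (fun w hw => (hd w hw).differentiableAt.differentiableWithinAt) (fun w hw => (hd w hw).deriv)
  have hsum (w : ℂ) (hw : ‖w‖ ≤ 1) (n : ℕ) :
      ‖w ^ (n + 1) / ((n : ℂ) + 1) ^ 2‖ ≤ ‖1 / ((n : ℂ) + 1) ^ 2‖ := by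
    rw [norm_div, norm_div, norm_one, norm_pow]
    gcongr
    exact pow_le_one₀ (norm_nonneg _) hw
  have hIoo : Ioo (0 : ℝ) 1 ∈ 𝓝[>] (0 : ℝ) := Ioo_mem_nhdsGT zero_lt_one
  have hcont (f : ℝ → ℂ) (w : ℂ) (hf : Continuous f) (h0 : f 0 = w) :
      Tendsto f (𝓝[>] 0) (𝓝 w) := (hf.tendsto' 0 w h0).mono_left nhdsWithin_le_nhds
  -- The limit passes through the power series, dominated by `1/(n+1)²`. Thus only the series at the
  -- limit point `w` is needed, not continuity of `Li2` at `1`.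
  have t (f : ℝ → ℂ) (w : ℂ) (hf : Continuous f) (h0 : f 0 = w)
      (hn : ∀ x ∈ Ioo (0 : ℝ) 1, ‖f x‖ < 1) :
      Tendsto (fun x => Li2 (f x)) (𝓝[>] 0) (𝓝 (∑' n : ℕ, w ^ (n + 1) / ((n : ℂ) + 1) ^ 2)) := by
    have := tendsto_tsum_of_dominated_convergence (𝓕 := 𝓝[>] (0 : ℝ))
      (f := fun (x : ℝ) (n : ℕ) => (f x) ^ (n + 1) / ((n : ℂ) + 1) ^ 2)
      (g := fun n : ℕ => w ^ (n + 1) / ((n : ℂ) + 1) ^ 2)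
      hasSum_one_div_add_one_sq.summable.norm
      (fun n => hcont _ _ (by fun_prop) (by rw [h0]))
      (by filter_upwards [hIoo] with x hx n using hsum _ (hn x hx).le n)
    refine this.congr' ?_
    filter_upwards [hIoo] with x hx using (hasSum_Li2 (hn x hx)).tsum_eq
  have t1 := t (fun x => (x : ℂ)) 0 continuous_ofReal (by simp) (fun x hx => by
    rw [norm_real, Real.norm_of_nonneg hx.1.le]; exact hx.2)
  have t2 := t (fun x => ((1 - x : ℝ) : ℂ)) 1 (by fun_prop) (by simp) (fun x hx => by
    rw [norm_real, Real.norm_of_nonneg (by linarith [hx.2])]; linarith [hx.1])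
  have t3 : Tendsto (fun x : ℝ => log (x : ℂ) * log (1 - (x : ℂ))) (𝓝[>] 0) (𝓝 0) := by
    -- Write `log x · log(1-x)` as `(x log x) · (log(1-x)/x)`, with limit `0 · (-1)`.
    have hr : Tendsto (fun x : ℝ => Real.log x * x * (Real.log (1 - x) / x)) (𝓝[>] 0)
        (𝓝 (0 * -1)) := by
      have hlog : Tendsto (fun x : ℝ => Real.log x * x) (𝓝[>] 0) (𝓝 0) := by
        simpa [mul_comm] using
          (Real.continuous_mul_log.tendsto' 0 0 (by simp)).mono_left (nhdsWithin_le_nhds (s := Ioi 0))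
      refine hlog.mul ?_
      have h0 : HasDerivAt (fun x : ℝ => Real.log (1 - x)) (-1) 0 := by
        simpa using ((hasDerivAt_id (0 : ℝ)).const_sub 1).log (by simp)
      refine ((hasDerivAt_iff_tendsto_slope.1 h0).mono_left
        (nhdsWithin_mono _ fun x hx => ne_of_gt hx)).congr fun x => ?_
      simp [slope_def_field]
    have hc := (continuous_ofReal.tendsto _).comp hr
    rw [zero_mul, ofReal_zero] at hc
    refine hc.congr' ?_
    filter_upwards [hIoo] with x hx
    have hx0 : (x : ℂ) ≠ 0 := by exact_mod_cast hx.1.ne'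
    have e1 : log (1 - (x : ℂ)) = (Real.log (1 - x) : ℂ) := by
      rw [ofReal_log (by linarith [hx.2])]; push_cast; rfl
    simp only [Function.comp_apply]
    rw [e1, ← ofReal_log hx.1.le]
    push_cast
    field_simp
  have tF := (t1.add t2).add t3
  have hconst : Tendsto (fun x : ℝ => F x) (𝓝[>] 0) (𝓝 a) :=
    tendsto_const_nhds.congr' (by
      filter_upwards [hIoo] with x hx using (ha _ (ofReal_mem_Omega hx)).symm)
  have := tendsto_nhds_unique hconst (tF.congr fun x => by simp [hF])
  change F z = _
  rw [ha z hz, this]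
  simp only [one_pow, hasSum_one_div_add_one_sq.tsum_eq]
  simp

/-! ### Local expansions of `g` at `0` and `1` -/

theorem norm_natCast_add_one (n : ℕ) : ‖(n : ℂ) + 1‖ = n + 1 := by
  rw [← Nat.cast_add_one, norm_natCast]
  push_cast
  rfl

theorem natCast_add_one_ne_zero (n : ℕ) : (n : ℂ) + 1 ≠ 0 := Nat.cast_add_one_ne_zero n

/-- Cauchy square of the logarithm series. With `k + l = n`, partial fractions split
`1/((k+1)(l+1))` as `(1/(k+1) + 1/(l+1))/(n+2)`, and each half sums to `H_{n+1}`. -/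
theorem hasSum_harmonic_pow {z : ℂ} (hz : ‖z‖ < 1) :
    HasSum (fun n : ℕ => ((harmonic n : ℚ) : ℂ) / ((n : ℂ) + 1) * z ^ (n + 1))
      (1 / 2 * log (1 - z) ^ 2) := by
  have hlog := hasSum_taylorSeries_neg_log' hz
  have hnorm : Summable (fun n : ℕ => ‖z ^ (n + 1) / ((n : ℂ) + 1)‖) := by
    refine Summable.of_nonneg_of_le (fun n => norm_nonneg _) (fun n => ?_)
      ((summable_geometric_of_lt_one (norm_nonneg z) hz).mul_left ‖z‖)
    rw [norm_div, norm_pow, norm_natCast_add_one, ← pow_succ']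
    exact div_le_self (by positivity) (by simp)
  have hprod := tsum_mul_tsum_eq_tsum_sum_antidiagonal_of_summable_norm hnorm hnorm
  have hsum := (summable_norm_sum_mul_antidiagonal_of_summable_norm hnorm hnorm).of_norm.hasSum
  rw [← hprod, hlog.tsum_eq] at hsum
  have hterm (n : ℕ) : ∑ kl ∈ Finset.HasAntidiagonal.antidiagonal n,
      z ^ (kl.1 + 1) / ((kl.1 : ℂ) + 1) * (z ^ (kl.2 + 1) / ((kl.2 : ℂ) + 1)) =
      2 * (((harmonic (n + 1) : ℚ) : ℂ) / (((n + 1 : ℕ) : ℂ) + 1) * z ^ (n + 1 + 1)) := by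
    have h1 : ∑ kl ∈ Finset.HasAntidiagonal.antidiagonal n, 1 / ((kl.1 : ℂ) + 1) =
        ((harmonic (n + 1) : ℚ) : ℂ) := by
      rw [Finset.Nat.sum_antidiagonal_eq_sum_range_succ_mk, harmonic]
      push_cast
      simp
    have h2 : ∑ kl ∈ Finset.HasAntidiagonal.antidiagonal n, 1 / ((kl.2 : ℂ) + 1) =
        ((harmonic (n + 1) : ℚ) : ℂ) := by
      rw [← h1]
      exact Finset.Nat.sum_antidiagonal_swap (f := fun kl : ℕ × ℕ => 1 / ((kl.1 : ℂ) + 1))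
    have h3 : 2 * (((harmonic (n + 1) : ℚ) : ℂ) / (((n + 1 : ℕ) : ℂ) + 1) * z ^ (n + 1 + 1)) =
        ∑ kl ∈ Finset.HasAntidiagonal.antidiagonal n, z ^ (n + 2) / (((n + 1 : ℕ) : ℂ) + 1) *
          (1 / ((kl.1 : ℂ) + 1) + 1 / ((kl.2 : ℂ) + 1)) := by
      rw [← Finset.mul_sum, Finset.sum_add_distrib, h1, h2]
      ring
    rw [h3]
    refine Finset.sum_congr rfl fun kl hkl => ?_
    rw [Finset.HasAntidiagonal.mem_antidiagonal] at hkl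
    subst hkl
    have e1 := natCast_add_one_ne_zero kl.1
    have e2 := natCast_add_one_ne_zero kl.2
    have e3 := natCast_add_one_ne_zero (kl.1 + kl.2 + 1)
    push_cast at e3 ⊢
    field_simp
    ring
  -- The square starts at `z²`; since `H_0 = 0`, the extra term of index `0` vanishes.
  have h := (hasSum_nat_add_iff' (f := fun n : ℕ => ((harmonic n : ℚ) : ℂ) / ((n : ℂ) + 1) *
    z ^ (n + 1)) (g := 1 / 2 * log (1 - z) ^ 2) 1).1
  apply h
  simp only [Finset.range_one, Finset.sum_singleton, harmonic_zero, Rat.cast_zero, zero_div,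
    zero_mul, sub_zero]
  have h' := hsum.mul_left (1 / 2)
  rw [show (1 / 2 : ℂ) * (-log (1 - z) * -log (1 - z)) = 1 / 2 * log (1 - z) ^ 2 by ring] at h'
  refine h'.congr_fun fun n => ?_
  rw [hterm]
  ring

/-- The sum is the part of `g` without `log z`, once reflection has been applied. -/
theorem hasSum_A {z : ℂ} (hz : ‖z‖ < 1) (hz0 : z ≠ 0) :
    HasSum (fun n : ℕ => A n * z ^ n) ((1 / 2 * log (1 - z) ^ 2 - Li2 z) / z) := by
  refine (((hasSum_harmonic_pow hz).sub (hasSum_Li2 hz)).div_const z).congr_fun fun n => ?_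
  have := natCast_add_one_ne_zero n
  simp only [A, harmonic_succ]
  push_cast
  rw [pow_succ]
  field_simp
  ring

theorem hasSum_B {z : ℂ} (hz : ‖z‖ < 1) (hz0 : z ≠ 0) :
    HasSum (fun n : ℕ => B n * z ^ n) (-log (1 - z) / z) := by
  refine ((hasSum_taylorSeries_neg_log' hz).div_const z).congr_fun fun n => ?_
  simp only [B]
  rw [pow_succ]
  field_simp

theorem hasSum_D {w : ℂ} (hw : ‖w‖ < 1) :
    HasSum (fun n : ℕ => D n * w ^ n) (1 / 2 * (1 / (1 - w))) := by
  rw [one_div (1 - w)]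
  exact (hasSum_geometric_of_norm_lt_one hw).mul_left (1 / 2)

theorem C_eq (n : ℕ) :
    C n = ∑ k ∈ Finset.range n, 1 / ((k : ℂ) + 1) ^ 2 - (Real.pi : ℂ) ^ 2 / 6 := by
  rw [C, deriv_digamma_nat_add_one]
  ring

/-- Uniform bounds on the coefficients are all that the Watson lemma and the majorant of `g` require
of them. -/
theorem norm_A_le (n : ℕ) : ‖A n‖ ≤ 3 := by
  have h1 : ((harmonic (n + 1) : ℚ) : ℝ) ≤ n + 1 := by
    rw [harmonic]
    push_cast
    calc ∑ i ∈ Finset.range (n + 1), ((i : ℝ) + 1)⁻¹ ≤ ∑ i ∈ Finset.range (n + 1), (1 : ℝ) :=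
          Finset.sum_le_sum fun i _ => inv_le_one_of_one_le₀ (by simp)
      _ = n + 1 := by simp
  have h0 : (0 : ℝ) ≤ ((harmonic (n + 1) : ℚ) : ℝ) := by
    exact_mod_cast (harmonic_pos n.succ_ne_zero).le
  have hn : (1 : ℝ) ≤ n + 1 := by simp
  have h2 : ‖((harmonic (n + 1) : ℚ) : ℂ) / ((n : ℂ) + 1)‖ ≤ 1 := by
    rw [norm_div, norm_natCast_add_one, ← ofReal_ratCast, norm_real, Real.norm_of_nonneg h0]
    exact div_le_one_of_le₀ h1 (by positivity)
  have h3 : ‖2 / ((n : ℂ) + 1) ^ 2‖ ≤ 2 := by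
    rw [norm_div, norm_pow, norm_natCast_add_one, norm_ofNat]
    exact div_le_self (by positivity) (one_le_pow₀ hn)
  exact (norm_sub_le _ _).trans (by linarith)

theorem norm_B_le (n : ℕ) : ‖B n‖ ≤ 1 := by
  rw [B, norm_div, norm_natCast_add_one, norm_one]
  exact div_le_one_of_le₀ (by simp) (by positivity)

theorem norm_D_le (n : ℕ) : ‖D n‖ ≤ 1 := by
  rw [D]
  norm_num

theorem exists_norm_C_le : ∃ K : ℝ, ∀ n, ‖C n‖ ≤ K := by
  have h := (hasSum_one_div_add_one_sq.tendsto_sum_nat).sub_const ((Real.pi : ℂ) ^ 2 / 6)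
  obtain ⟨K, hK⟩ := h.norm.bddAbove_range
  refine ⟨K, fun n => ?_⟩
  rw [C_eq]
  exact hK ⟨n, rfl⟩

theorem summable_norm_mul_pow {a : ℕ → ℂ} {K : ℝ} (ha : ∀ n, ‖a n‖ ≤ K) {z : ℂ} (hz : ‖z‖ < 1) :
    Summable (fun n => ‖a n * z ^ n‖) := by
  refine Summable.of_nonneg_of_le (fun n => norm_nonneg _) (fun n => ?_)
    ((summable_geometric_of_lt_one (norm_nonneg z) hz).mul_left K)
  rw [norm_mul, norm_pow]
  exact mul_le_mul_of_nonneg_right (ha n) (by positivity)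

/-- Multiplication by `1 - w` telescopes: `C_{n+1} - C_n = 1/(n+1)²` gives the series of `Li2 w`,
and `C_0 = -π²/6` the constant. -/
theorem hasSum_C {w : ℂ} (hw : ‖w‖ < 1) :
    HasSum (fun n : ℕ => C n * w ^ n) ((Li2 w - (Real.pi : ℂ) ^ 2 / 6) * (1 / (1 - w))) := by
  have hw1 : 1 - w ≠ 0 := by
    intro h
    rw [sub_eq_zero] at h
    simp [← h] at hw
  obtain ⟨K, hK⟩ := exists_norm_C_le
  have hs := (summable_norm_mul_pow hK hw).of_norm
  have h1 := (hasSum_nat_add_iff' 1).2 hs.hasSum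
  have h2 := h1.sub (hs.hasSum.mul_left w)
  have h3 : HasSum (fun n : ℕ => C (n + 1) * w ^ (n + 1) - w * (C n * w ^ n)) (Li2 w) := by
    refine (hasSum_Li2 hw).congr_fun fun n => ?_
    rw [C_eq, C_eq, Finset.sum_range_succ]
    ring
  have h4 := h2.unique h3
  have h5 : ∑' n : ℕ, C n * w ^ n = (Li2 w - (Real.pi : ℂ) ^ 2 / 6) * (1 / (1 - w)) := by
    simp only [Finset.range_one, Finset.sum_singleton, C_eq 0, Finset.range_zero, Finset.sum_empty,
      pow_zero] at h4
    field_simp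
    linear_combination 6 * h4
  rw [← h5]
  exact hs.hasSum

theorem g_expansion_zero {z : ℂ} (hz : z ∈ Omega) (hz1 : ‖z‖ < 1) :
    g z = (∑' n : ℕ, A n * z ^ n) + (∑' n : ℕ, B n * z ^ n) * log z := by
  have hz0 : z ≠ 0 := by
    rintro rfl
    exact hz ⟨rfl, Or.inl le_rfl⟩
  rw [(hasSum_A hz1 hz0).tsum_eq, (hasSum_B hz1 hz0).tsum_eq, g]
  have := Li2_reflection hz
  field_simp
  linear_combination 12 * this

theorem g_expansion_one {z : ℂ} (hz1 : ‖1 - z‖ < 1) :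
    g z = (∑' n : ℕ, C n * (1 - z) ^ n) + (∑' n : ℕ, D n * (1 - z) ^ n) * log (1 - z) ^ 2 := by
  rw [(hasSum_C hz1).tsum_eq, (hasSum_D hz1).tsum_eq, g, sub_sub_cancel]
  ring

theorem differentiableOn_g : DifferentiableOn ℂ g Omega := by
  intro z hz
  have hz' := hz
  rw [Omega_eq] at hz'
  obtain ⟨h1, h2⟩ := hz'
  have hm : DifferentiableAt ℂ (fun z : ℂ => 1 - z) z := by fun_prop
  have hL : DifferentiableAt ℂ (fun z : ℂ => Li2 (1 - z)) z :=
    ((hasDerivAt_Li2 (z := 1 - z) (by simpa using h1)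
      (slitPlane_ne_zero h2)).comp_const_sub 1 z).differentiableAt
  have hz0 := slitPlane_ne_zero h1
  unfold g
  exact ((((hm.clog h2).pow 2).const_mul _ |>.sub_const _ |>.add hL).mul
    ((differentiableAt_const _).div differentiableAt_id hz0)).differentiableWithinAt

/-! ### A Watson lemma with logarithms -/

theorem integrableOn_pow_mul_logExp (n j : ℕ) :
    IntegrableOn (fun u : ℝ => (u : ℂ) ^ n * logExp j u) (Ioi 0) := by
  have h := mellinConvergent_logExp j (s := (n : ℂ) + 1) (by simp; positivity)
  simpa [MellinConvergent] using h

theorem integral_pow_mul_logExp (n j : ℕ) :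
    ∫ u : ℝ in Ioi 0, (u : ℂ) ^ n * logExp j u = mellin (logExp j) ((n : ℂ) + 1) := by
  simp [mellin]

/-- An integrable majorant for the integrals of Laplace type with logarithms. -/
noncomputable def logWeight (n : ℕ) (d u : ℝ) : ℝ := u ^ n * (|Real.log u| + d) ^ 2 * Real.exp (-u)

theorem integrableOn_logWeight (n : ℕ) (d : ℝ) : IntegrableOn (logWeight n d) (Ioi 0) := by
  have h := ((integrableOn_pow_mul_logExp n 2).norm.const_mul 2).add
    ((integrableOn_pow_mul_logExp n 0).norm.const_mul (2 * d ^ 2))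
  refine Integrable.mono' h ?_ ?_
  · have : Measurable (logWeight n d) := by
      unfold logWeight
      have := Real.measurable_log
      fun_prop
    exact this.aestronglyMeasurable
  · refine (ae_restrict_iff' measurableSet_Ioi).2 (Eventually.of_forall fun u hu => ?_)
    have hu' : 0 < u := hu
    have h1 : 0 ≤ u ^ n * Real.exp (-u) := by positivity
    have h2 : (|Real.log u| + d) ^ 2 ≤ 2 * Real.log u ^ 2 + 2 * d ^ 2 := by
      nlinarith [sq_nonneg (|Real.log u| - d), sq_abs (Real.log u)]
    simp only [logWeight, logExp, norm_mul, norm_pow, norm_real, pow_zero, Pi.add_apply, one_mul,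
      Real.norm_eq_abs, abs_of_pos hu', Real.abs_exp, sq_abs]
    nlinarith [mul_le_mul_of_nonneg_left h2 h1]

/-- Put `u = t y`, so `log y = log u - log t`. As `t ≥ e` gives `log t ≥ 1`, one has `|log y + c| ≤
log t · (|log u| + 1 + ‖c‖)`. Both factors are at least `1`, so any power `k ≤ 2` may be raised to
`2`. -/
theorem norm_laplace_integrand_le {E : ℝ → ℂ} {K : ℝ} {N k : ℕ} {c : ℂ} (hk : k ≤ 2)
    (hE : ∀ y, 0 < y → ‖E y‖ ≤ K * y ^ N) {t : ℝ} (ht : Real.exp 1 ≤ t) {y : ℝ} (hy : 0 < y) :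
    ‖E y * ((Real.log y : ℂ) + c) ^ k * cexp (-((y : ℂ) * t))‖ ≤
      K * (Real.log t ^ 2 / t ^ N) * logWeight N (1 + ‖c‖) (t * y) := by
  have ht0 : 0 < t := (Real.exp_pos 1).trans_le ht
  have hlt : 1 ≤ Real.log t := by
    rw [← Real.log_exp 1]
    exact Real.log_le_log (Real.exp_pos 1) ht
  have hlog : Real.log (t * y) = Real.log t + Real.log y := Real.log_mul ht0.ne' hy.ne'
  have hexp : ‖cexp (-((y : ℂ) * t))‖ = Real.exp (-(t * y)) := by
    rw [norm_exp]
    simp [mul_comm]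
  set P := |Real.log (t * y)| + (1 + ‖c‖) with hP
  have hP1 : 1 ≤ P := by
    have := abs_nonneg (Real.log (t * y))
    have := norm_nonneg c
    linarith
  have h1 : ‖(Real.log y : ℂ) + c‖ ≤ Real.log t * P := by
    have h2 : ‖(Real.log y : ℂ) + c‖ ≤ |Real.log y| + ‖c‖ := by
      refine (norm_add_le _ _).trans ?_
      rw [norm_real, Real.norm_eq_abs]
    have h3 : |Real.log y| ≤ |Real.log (t * y)| + Real.log t := by
      have : Real.log y = Real.log (t * y) - Real.log t := by rw [hlog]; ring
      rw [this]
      refine (abs_sub _ _).trans ?_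
      rw [abs_of_nonneg (by linarith : 0 ≤ Real.log t)]
    have h4 := abs_nonneg (Real.log (t * y))
    have h5 := norm_nonneg c
    nlinarith
  have h2 : ‖(Real.log y : ℂ) + c‖ ^ k ≤ (Real.log t * P) ^ 2 :=
    (pow_le_pow_left₀ (norm_nonneg _) h1 k).trans
      (pow_le_pow_right₀ (one_le_mul_of_one_le_of_one_le hlt hP1) hk)
  have hK : 0 ≤ K * y ^ N := (norm_nonneg _).trans (hE y hy)
  rw [norm_mul, norm_mul, norm_pow, hexp]
  calc ‖E y‖ * ‖(Real.log y : ℂ) + c‖ ^ k * Real.exp (-(t * y))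
      ≤ K * y ^ N * (Real.log t * P) ^ 2 * Real.exp (-(t * y)) := by
        gcongr
        exact hE y hy
    _ = K * (Real.log t ^ 2 / t ^ N) * logWeight N (1 + ‖c‖) (t * y) := by
        rw [logWeight, ← hP, mul_pow t y]
        field_simp

theorem integrableOn_laplace {E : ℝ → ℂ} {K : ℝ} {N k : ℕ} (c : ℂ) (hk : k ≤ 2)
    (hEm : AEStronglyMeasurable E (volume.restrict (Ioi 0)))
    (hE : ∀ y, 0 < y → ‖E y‖ ≤ K * y ^ N) {t : ℝ} (ht : Real.exp 1 ≤ t) :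
    IntegrableOn (fun y : ℝ => E y * ((Real.log y : ℂ) + c) ^ k * cexp (-((y : ℂ) * t)))
      (Ioi 0) := by
  have ht0 : 0 < t := (Real.exp_pos 1).trans_le ht
  have hW : IntegrableOn (fun y => logWeight N (1 + ‖c‖) (t * y)) (Ioi 0) := by
    rw [integrableOn_Ioi_comp_mul_left_iff _ _ ht0, mul_zero]
    exact integrableOn_logWeight _ _
  refine Integrable.mono' (hW.const_mul (K * (Real.log t ^ 2 / t ^ N))) ?_ ?_
  · have : Measurable (fun y : ℝ => ((Real.log y : ℂ) + c) ^ k) := by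
      have := Real.measurable_log
      fun_prop
    have h2 : Measurable (fun y : ℝ => cexp (-((y : ℂ) * t))) := by fun_prop
    exact (hEm.mul this.aestronglyMeasurable).mul h2.aestronglyMeasurable
  · exact (ae_restrict_iff' measurableSet_Ioi).2
      (Eventually.of_forall fun y hy => norm_laplace_integrand_le hk hE ht hy)

/-- Integrating the majorant in `u = t y` contributes the last factor `1/t`. -/
theorem laplace_isBigO {E : ℝ → ℂ} {K : ℝ} {N k : ℕ} (c : ℂ) (hk : k ≤ 2)
    (hE : ∀ y, 0 < y → ‖E y‖ ≤ K * y ^ N) :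
    (fun t : ℝ => ∫ y : ℝ in Ioi 0, E y * ((Real.log y : ℂ) + c) ^ k * cexp (-((y : ℂ) * t)))
      =O[atTop] (fun t : ℝ => Real.log t ^ 2 / t ^ (N + 1)) := by
  refine IsBigO.of_bound (K * ∫ u in Ioi 0, logWeight N (1 + ‖c‖) u) ?_
  filter_upwards [eventually_ge_atTop (Real.exp 1)] with t ht
  have ht0 : 0 < t := (Real.exp_pos 1).trans_le ht
  have hW : IntegrableOn (fun y => logWeight N (1 + ‖c‖) (t * y)) (Ioi 0) := by
    rw [integrableOn_Ioi_comp_mul_left_iff _ _ ht0, mul_zero]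
    exact integrableOn_logWeight _ _
  refine (norm_integral_le_of_norm_le (hW.const_mul (K * (Real.log t ^ 2 / t ^ N)))
    ((ae_restrict_iff' measurableSet_Ioi).2
      (Eventually.of_forall fun y hy => norm_laplace_integrand_le hk hE ht hy))).trans ?_
  rw [integral_const_mul, integral_comp_mul_left_Ioi _ _ ht0, mul_zero,
    Real.norm_of_nonneg (by positivity), smul_eq_mul]
  refine le_of_eq ?_
  field_simp
  ring

theorem norm_tsum_sub_sum_le {b : ℕ → ℂ} {K : ℝ} (hb : ∀ n, ‖b n‖ ≤ K) (N : ℕ) {y : ℝ}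
    (hy : y ∈ Ioo (0 : ℝ) (1 / 2)) :
    ‖(∑' n, b n * (y : ℂ) ^ n) - ∑ n ∈ Finset.range N, b n * (y : ℂ) ^ n‖ ≤ 2 * K * y ^ N := by
  have hyn : ‖(y : ℂ)‖ = y := by rw [norm_real, Real.norm_of_nonneg hy.1.le]
  have hy1 : ‖(y : ℂ)‖ < 1 := by rw [hyn]; linarith [hy.2]
  have hs := summable_norm_mul_pow hb hy1
  rw [← hs.of_norm.sum_add_tsum_nat_add N, add_sub_cancel_left]
  have hK : 0 ≤ K := (norm_nonneg _).trans (hb 0)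
  have hg := (hasSum_geometric_of_lt_one hy.1.le (by linarith [hy.2])).mul_left (K * y ^ N)
  refine (tsum_of_norm_bounded hg fun n => ?_).trans ?_
  · rw [norm_mul, norm_pow, hyn, pow_add]
    calc ‖b (n + N)‖ * (y ^ n * y ^ N) ≤ K * (y ^ n * y ^ N) :=
          mul_le_mul_of_nonneg_right (hb _)
            (mul_nonneg (pow_nonneg hy.1.le _) (pow_nonneg hy.1.le _))
      _ = K * y ^ N * y ^ n := by ring
  · have h2 : (1 - y)⁻¹ ≤ 2 := by
      rw [inv_le_comm₀ (by linarith [hy.2]) two_pos]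
      linarith [hy.2]
    have h3 : 0 ≤ K * y ^ N := mul_nonneg hK (pow_nonneg hy.1.le _)
    nlinarith

theorem norm_sum_le_of_half_le {b : ℕ → ℂ} {K : ℝ} (hb : ∀ n, ‖b n‖ ≤ K) (N : ℕ) {y : ℝ}
    (hy : 1 / 2 ≤ y) :
    ‖∑ n ∈ Finset.range N, b n * (y : ℂ) ^ n‖ ≤ N * K * 2 ^ N * y ^ N := by
  have hK : 0 ≤ K := (norm_nonneg _).trans (hb 0)
  have hy0 : 0 ≤ y := by linarith
  calc ‖∑ n ∈ Finset.range N, b n * (y : ℂ) ^ n‖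
      ≤ ∑ n ∈ Finset.range N, K * (2 ^ N * y ^ N) := by
        refine norm_sum_le_of_le _ fun n hn => ?_
        rw [norm_mul, norm_pow, norm_real, Real.norm_of_nonneg hy0]
        refine mul_le_mul (hb n) ?_ (pow_nonneg hy0 _) hK
        calc y ^ n ≤ (2 * y) ^ n := pow_le_pow_left₀ hy0 (by linarith) n
          _ ≤ (2 * y) ^ N := pow_le_pow_right₀ (by linarith) (Finset.mem_range.1 hn).le
          _ = 2 ^ N * y ^ N := mul_pow _ _ _
    _ = N * K * 2 ^ N * y ^ N := by
        rw [Finset.sum_const, Finset.card_range, nsmul_eq_mul]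
        ring

theorem continuousOn_tsum_mul_pow {b : ℕ → ℂ} {K : ℝ} (hb : ∀ n, ‖b n‖ ≤ K) :
    ContinuousOn (fun y : ℝ => ∑' n, b n * (y : ℂ) ^ n) (Ioo 0 (1 / 2)) := by
  have hK : 0 ≤ K := (norm_nonneg _).trans (hb 0)
  refine continuousOn_tsum (u := fun n => K * (1 / 2) ^ n) (fun n => by fun_prop)
    ((summable_geometric_of_lt_one (by norm_num) (by norm_num)).mul_left K) fun n y hy => ?_
  rw [norm_mul, norm_pow, norm_real, Real.norm_of_nonneg hy.1.le]
  exact mul_le_mul (hb n) (pow_le_pow_left₀ hy.1.le hy.2.le n) (pow_nonneg hy.1.le _) hK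

/-- The Laplace-type integrals to which the two vertical sides of the contour reduce. -/
noncomputable def sideIntegrand (b : ℕ → ℂ) (c : ℂ) (k : ℕ) (t y : ℝ) : ℂ :=
  (∑' n, b n * (y : ℂ) ^ n) * ((Real.log y : ℂ) + c) ^ k * cexp (-((y : ℂ) * t))

/-- Extend the series by zero beyond `1/2`. Minus its Taylor polynomial it is then `O(y^N)` on the
whole half-line: a geometric tail below `1/2`, and the polynomial alone above. This one bound
controls both truncating the series and extending the model integrals to infinity. -/
theorem watson {b : ℕ → ℂ} {K : ℝ} (hb : ∀ n, ‖b n‖ ≤ K) (c : ℂ) {k : ℕ} (hk : k ≤ 2) (N : ℕ) :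
    (∀ t : ℝ, Real.exp 1 ≤ t → IntervalIntegrable (sideIntegrand b c k t) volume 0 (1 / 2)) ∧
    (fun t : ℝ => (∫ y in (0 : ℝ)..(1 / 2), sideIntegrand b c k t y) -
      ∑ n ∈ Finset.range N, b n * ∫ y : ℝ in Ioi 0,
        (y : ℂ) ^ n * ((Real.log y : ℂ) + c) ^ k * cexp (-((y : ℂ) * t)))
      =O[atTop] (fun t : ℝ => Real.log t ^ 2 / t ^ (N + 1)) := by
  unfold sideIntegrand
  have hK : 0 ≤ K := (norm_nonneg _).trans (hb 0)
  set S : ℝ → ℂ := (Ioo (0 : ℝ) (1 / 2)).indicator fun y => ∑' n, b n * (y : ℂ) ^ n with hS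
  have hSm : AEStronglyMeasurable S (volume.restrict (Ioi 0)) :=
    ((aestronglyMeasurable_indicator_iff measurableSet_Ioo).2
      ((continuousOn_tsum_mul_pow hb).aestronglyMeasurable measurableSet_Ioo)).restrict
  have hE (M : ℕ) (y : ℝ) (hy : 0 < y) :
      ‖S y - ∑ n ∈ Finset.range M, b n * (y : ℂ) ^ n‖ ≤ (2 * K + M * K * 2 ^ M) * y ^ M := by
    have hyM : 0 ≤ y ^ M := by positivity
    have h1 : 0 ≤ 2 * K * y ^ M := by positivity
    have h2 : 0 ≤ M * K * 2 ^ M * y ^ M := by positivity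
    by_cases h : y < 1 / 2
    · have hm : y ∈ Ioo (0 : ℝ) (1 / 2) := ⟨hy, h⟩
      rw [hS, indicator_of_mem hm]
      linarith [norm_tsum_sub_sum_le hb M hm]
    · rw [hS, indicator_of_notMem fun hm => h hm.2, zero_sub, norm_neg]
      linarith [norm_sum_le_of_half_le hb M (not_lt.1 h)]
  have hEq (t : ℝ) : (fun y => S y * ((Real.log y : ℂ) + c) ^ k * cexp (-((y : ℂ) * t))) =
      (Ioo (0 : ℝ) (1 / 2)).indicator fun y : ℝ =>
        (∑' n, b n * (y : ℂ) ^ n) * ((Real.log y : ℂ) + c) ^ k * cexp (-((y : ℂ) * t)) := by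
    funext y
    by_cases h : y ∈ Ioo (0 : ℝ) (1 / 2)
    · simp only [hS, indicator_of_mem h]
    · simp only [hS, indicator_of_notMem h, zero_mul]
  have hSi (t : ℝ) (ht : Real.exp 1 ≤ t) : IntegrableOn
      (fun y => S y * ((Real.log y : ℂ) + c) ^ k * cexp (-((y : ℂ) * t))) (Ioi 0) :=
    -- At order `0` the remainder bound says that `S` itself is bounded by `2K`.
    integrableOn_laplace (K := 2 * K) (N := 0) c hk hSm (fun y hy => by simpa using hE 0 y hy) ht
  have hPi (n : ℕ) (t : ℝ) (ht : Real.exp 1 ≤ t) : IntegrableOn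
      (fun y : ℝ => (y : ℂ) ^ n * ((Real.log y : ℂ) + c) ^ k * cexp (-((y : ℂ) * t))) (Ioi 0) :=
    integrableOn_laplace (K := 1) (N := n) c hk
      (by fun_prop : Continuous fun y : ℝ => (y : ℂ) ^ n).aestronglyMeasurable
      (fun y hy => by rw [norm_pow, norm_real, Real.norm_of_nonneg hy.le, one_mul]) ht
  refine ⟨fun t ht => ?_, ?_⟩
  · rw [intervalIntegrable_iff_integrableOn_Ioo_of_le (by norm_num)]
    have h := hSi t ht
    rw [hEq, integrableOn_indicator_iff measurableSet_Ioo] at h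
    rwa [inter_eq_left.2 Ioo_subset_Ioi_self] at h
  · refine (laplace_isBigO c hk (hE N)).congr' ?_ EventuallyEq.rfl
    filter_upwards [eventually_ge_atTop (Real.exp 1)] with t ht
    have h1 : ∫ y in (0 : ℝ)..(1 / 2),
        (∑' n, b n * (y : ℂ) ^ n) * ((Real.log y : ℂ) + c) ^ k * cexp (-((y : ℂ) * t)) =
        ∫ y in Ioi 0, S y * ((Real.log y : ℂ) + c) ^ k * cexp (-((y : ℂ) * t)) := by
      rw [hEq, setIntegral_indicator measurableSet_Ioo, inter_eq_right.2 Ioo_subset_Ioi_self,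
        intervalIntegral.integral_of_le (by norm_num), integral_Ioc_eq_integral_Ioo]
    simp_rw [h1, ← integral_const_mul]
    rw [← integral_finsetSum _ fun n _ => (hPi n t ht).const_mul (b n),
      ← integral_sub (hSi t ht) (integrable_finsetSum _ fun n _ => (hPi n t ht).const_mul (b n))]
    refine integral_congr_ae (Eventually.of_forall fun y => ?_)
    simp only [sub_mul, Finset.sum_mul]
    congr 1
    exact Finset.sum_congr rfl fun n _ => by ring

/-! ### Exact values of the model integrals -/

theorem integral_pow_mul_log_pow_mul_exp (n k : ℕ) (c : ℂ) {t : ℝ} (ht : 0 < t) :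
    ∫ y : ℝ in Ioi 0, (y : ℂ) ^ n * ((Real.log y : ℂ) + c) ^ k * cexp (-((y : ℂ) * t)) =
      1 / (t : ℂ) ^ (n + 1) * ∫ u : ℝ in Ioi 0,
        (u : ℂ) ^ n * ((Real.log u : ℂ) + (c - Real.log t)) ^ k * cexp (-(u : ℂ)) := by
  have htc : (t : ℂ) ≠ 0 := by exact_mod_cast ht.ne'
  have h := integral_comp_mul_left_Ioi (fun u : ℝ => 1 / (t : ℂ) ^ n *
    ((u : ℂ) ^ n * ((Real.log u : ℂ) + (c - Real.log t)) ^ k * cexp (-(u : ℂ)))) 0 ht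
  rw [mul_zero, integral_const_mul (1 / (t : ℂ) ^ n) (fun u : ℝ => (u : ℂ) ^ n *
    ((Real.log u : ℂ) + (c - Real.log t)) ^ k * cexp (-(u : ℂ))), real_smul] at h
  have h2 : ∫ y : ℝ in Ioi 0, (y : ℂ) ^ n * ((Real.log y : ℂ) + c) ^ k * cexp (-((y : ℂ) * t)) =
      ∫ y : ℝ in Ioi 0, 1 / (t : ℂ) ^ n * (((t * y : ℝ) : ℂ) ^ n *
        ((Real.log (t * y) : ℂ) + (c - Real.log t)) ^ k * cexp (-((t * y : ℝ) : ℂ))) := by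
    refine setIntegral_congr_fun measurableSet_Ioi fun y hy => ?_
    have hlog : Real.log (t * y) = Real.log t + Real.log y :=
      Real.log_mul ht.ne' (ne_of_gt hy)
    simp only [hlog]
    push_cast
    rw [mul_pow, show (Real.log t : ℂ) + Real.log y + (c - Real.log t) = Real.log y + c by ring,
      mul_comm (t : ℂ) (y : ℂ)]
    field_simp
  rw [h2, h]
  push_cast
  field_simp
  ring

theorem mellin_logExp_nat (n : ℕ) :
    mellin (logExp 0) ((n : ℂ) + 1) = n.factorial ∧
    mellin (logExp 1) ((n : ℂ) + 1) = n.factorial * digamma ((n : ℂ) + 1) ∧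
    mellin (logExp 2) ((n : ℂ) + 1) =
      n.factorial * (deriv digamma ((n : ℂ) + 1) + digamma ((n : ℂ) + 1) ^ 2) := by
  have h : 0 < ((n : ℂ) + 1).re := by simp; positivity
  rw [mellin_logExp_zero h, mellin_logExp_one h, mellin_logExp_two h, Gamma_nat_eq_factorial]
  exact ⟨rfl, rfl, rfl⟩

theorem laplace_zero (n : ℕ) (c : ℂ) {t : ℝ} (ht : 0 < t) :
    ∫ y : ℝ in Ioi 0, (y : ℂ) ^ n * ((Real.log y : ℂ) + c) ^ 0 * cexp (-((y : ℂ) * t)) =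
      n.factorial / (t : ℂ) ^ (n + 1) := by
  have h : ∫ u : ℝ in Ioi 0, (u : ℂ) ^ n * ((Real.log u : ℂ) + (c - Real.log t)) ^ 0 *
      cexp (-(u : ℂ)) = n.factorial := by
    rw [← (mellin_logExp_nat n).1, ← integral_pow_mul_logExp]
    refine setIntegral_congr_fun measurableSet_Ioi fun u _ => ?_
    simp [logExp]
  rw [integral_pow_mul_log_pow_mul_exp n 0 c ht, h]
  ring

theorem laplace_one (n : ℕ) (c : ℂ) {t : ℝ} (ht : 0 < t) :
    ∫ y : ℝ in Ioi 0, (y : ℂ) ^ n * ((Real.log y : ℂ) + c) ^ 1 * cexp (-((y : ℂ) * t)) =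
      (digamma ((n : ℂ) + 1) - Real.log t + c) * (n.factorial / (t : ℂ) ^ (n + 1)) := by
  have h : ∫ u : ℝ in Ioi 0, (u : ℂ) ^ n * ((Real.log u : ℂ) + (c - Real.log t)) ^ 1 *
      cexp (-(u : ℂ)) = n.factorial * (digamma ((n : ℂ) + 1) + (c - Real.log t)) := by
    rw [mul_add, ← (mellin_logExp_nat n).2.1]
    conv_rhs => rw [← (mellin_logExp_nat n).1]
    rw [← integral_pow_mul_logExp, ← integral_pow_mul_logExp, ← integral_mul_const,
      ← integral_add (integrableOn_pow_mul_logExp n 1)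
        ((integrableOn_pow_mul_logExp n 0).mul_const _)]
    refine setIntegral_congr_fun measurableSet_Ioi fun u _ => ?_
    simp only [logExp, ofReal_exp, ofReal_neg]
    ring
  rw [integral_pow_mul_log_pow_mul_exp n 1 c ht, h]
  ring

/-- Under the normalised Gamma weight `u^n exp(-u)/n!`, `log u` has mean `Ψ(n+1)` and variance
`Ψ'(n+1)`; this is its second moment about a shifted origin. -/
theorem laplace_two (n : ℕ) (c : ℂ) {t : ℝ} (ht : 0 < t) :
    ∫ y : ℝ in Ioi 0, (y : ℂ) ^ n * ((Real.log y : ℂ) + c) ^ 2 * cexp (-((y : ℂ) * t)) =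
      (deriv digamma ((n : ℂ) + 1) + (digamma ((n : ℂ) + 1) - Real.log t + c) ^ 2) *
        (n.factorial / (t : ℂ) ^ (n + 1)) := by
  set c' : ℂ := c - Real.log t with hc'
  have h : ∫ u : ℝ in Ioi 0, (u : ℂ) ^ n * ((Real.log u : ℂ) + c') ^ 2 *
      cexp (-(u : ℂ)) = n.factorial * (deriv digamma ((n : ℂ) + 1) +
        (digamma ((n : ℂ) + 1) + c') ^ 2) := by
    have e : (n.factorial : ℂ) * (deriv digamma ((n : ℂ) + 1) + (digamma ((n : ℂ) + 1) + c') ^ 2) =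
        mellin (logExp 2) ((n : ℂ) + 1) + (mellin (logExp 1) ((n : ℂ) + 1) * (2 * c') +
          mellin (logExp 0) ((n : ℂ) + 1) * c' ^ 2) := by
      rw [(mellin_logExp_nat n).1, (mellin_logExp_nat n).2.1, (mellin_logExp_nat n).2.2]
      ring
    have i2 := integrableOn_pow_mul_logExp n 2
    have i1 := (integrableOn_pow_mul_logExp n 1).mul_const (2 * c')
    have i0 := (integrableOn_pow_mul_logExp n 0).mul_const (c' ^ 2)
    rw [e, ← integral_pow_mul_logExp, ← integral_pow_mul_logExp, ← integral_pow_mul_logExp,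
      ← integral_mul_const, ← integral_mul_const, ← integral_add i1 i0,
      ← integral_add i2 (g := fun u : ℝ => (u : ℂ) ^ n * logExp 1 u * (2 * c') +
        (u : ℂ) ^ n * logExp 0 u * c' ^ 2) (i1.add i0)]
    refine setIntegral_congr_fun measurableSet_Ioi fun u _ => ?_
    simp only [logExp, ofReal_exp, ofReal_neg]
    ring
  rw [integral_pow_mul_log_pow_mul_exp n 2 c ht, ← hc', h, hc']
  ring

/-! ### A majorant for `g` uniform in the height -/

theorem norm_log_le {z : ℂ} {x : ℝ} (hx : 0 < x) (hxz : x ≤ ‖z‖) (hz : ‖z‖ ≤ 1) :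
    ‖log z‖ ≤ |Real.log x| + Real.pi := by
  have h1 : |Real.log ‖z‖| ≤ |Real.log x| := by
    rw [abs_of_nonpos (Real.log_nonpos (norm_nonneg _) hz),
      abs_of_nonpos (Real.log_nonpos hx.le (hxz.trans hz))]
    exact neg_le_neg (Real.log_le_log hx hxz)
  calc ‖log z‖ ≤ |(log z).re| + |(log z).im| := norm_le_abs_re_add_abs_im _
    _ ≤ |Real.log x| + Real.pi := by
      rw [log_re, log_im]
      exact add_le_add h1 (abs_arg_le_pi z)

theorem norm_tsum_mul_pow_le {a : ℕ → ℂ} {K : ℝ} (ha : ∀ n, ‖a n‖ ≤ K) {z : ℂ}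
    (hz : ‖z‖ ≤ 3 / 4) : ‖∑' n, a n * z ^ n‖ ≤ K * 4 := by
  have hg := (hasSum_geometric_of_lt_one (r := (3 / 4 : ℝ)) (by norm_num) (by norm_num)).mul_left K
  refine (tsum_of_norm_bounded hg fun n => ?_).trans (by norm_num)
  rw [norm_mul, norm_pow]
  exact mul_le_mul (ha n) (pow_le_pow_left₀ (norm_nonneg _) hz n) (by positivity)
    ((norm_nonneg _).trans (ha 0))

/-- The square of an upper bound for `|log z|` when `x ≤ |z| ≤ 1`. -/
noncomputable def logSq (x : ℝ) : ℝ := (|Real.log x| + Real.pi) ^ 2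

theorem logSq_nonneg (x : ℝ) : 0 ≤ logSq x := sq_nonneg _

theorem intervalIntegrable_logSq : IntervalIntegrable logSq volume 0 1 := by
  rw [intervalIntegrable_iff_integrableOn_Ioo_of_le zero_le_one]
  have h : IntegrableOn (fun u => Real.exp 1 * logWeight 0 Real.pi u) (Ioo 0 1) :=
    ((integrableOn_logWeight 0 Real.pi).mono_set Ioo_subset_Ioi_self).const_mul (Real.exp 1)
  refine Integrable.mono' h ?_ ?_
  · have : Measurable logSq := by
      unfold logSq
      have := Real.measurable_log
      fun_prop
    exact this.aestronglyMeasurable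
  · refine (ae_restrict_iff' measurableSet_Ioo).2 (Eventually.of_forall fun u hu => ?_)
    rw [Real.norm_of_nonneg (logSq_nonneg u), logWeight, pow_zero, one_mul, mul_left_comm,
      ← Real.exp_add]
    exact le_mul_of_one_le_right (logSq_nonneg u) (Real.one_le_exp (by linarith [hu.2]))

theorem intervalIntegrable_logSq_bound (M : ℝ) :
    IntervalIntegrable (fun x => M * (1 + logSq x + logSq (1 - x))) volume 0 1 := by
  have h : IntervalIntegrable (fun x => logSq (1 - x)) volume 0 1 := by
    simpa using (intervalIntegrable_logSq.comp_sub_left 1).symm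
  exact ((intervalIntegrable_const.add intervalIntegrable_logSq).add h).const_mul M

theorem re_add_im_mem_Omega {x y : ℝ} (hx : x ∈ Ioo (0 : ℝ) 1) : (x : ℂ) + y * I ∈ Omega := by
  by_cases hy : y = 0
  · simpa [hy] using ofReal_mem_Omega hx
  · exact mem_Omega_of_im_ne_zero (by simpa using hy)

/-- For heights up to `1/2`, each half of the strip lies within `√2/2 < 3/4` of `0` or `1`, where
the local expansion applies. The bound depends on `x` alone, so it dominates all horizontal lines at
once. -/
theorem exists_norm_g_le : ∃ M : ℝ, ∀ x ∈ Ioo (0 : ℝ) 1, ∀ y ∈ Icc (0 : ℝ) (1 / 2),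
    ‖g (x + y * I)‖ ≤ M * (1 + logSq x + logSq (1 - x)) := by
  obtain ⟨K, hK⟩ := exists_norm_C_le
  have hK0 : 0 ≤ K := (norm_nonneg _).trans (hK 0)
  -- On `‖z‖ ≤ 3/4` a power series is at most `4` times its coefficient bound: `4·3` from `A`, `4·K`
  -- from `C`, and `4` from `B` or `D`.
  refine ⟨12 + 4 * K, fun x hx y hy => ?_⟩
  have hsmall {a : ℝ} (ha0 : 0 ≤ a) (ha : a ≤ 1 / 2) {w : ℂ} (hre : w.re = a)
      (him : w.im ^ 2 = y ^ 2) : ‖w‖ ≤ 3 / 4 := by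
    refine abs_le_of_sq_le_sq' ?_ (by norm_num) |>.2
    rw [← normSq_eq_norm_sq, normSq_apply, hre]
    nlinarith [hy.1, hy.2]
  have hpi := Real.pi_gt_three
  have h1 := logSq_nonneg x
  have h2 := logSq_nonneg (1 - x)
  rcases le_total x (1 / 2) with h | h
  · have hn : ‖(x : ℂ) + y * I‖ ≤ 3 / 4 := hsmall hx.1.le h (by simp) (by simp)
    have hxn : x ≤ ‖(x : ℂ) + y * I‖ := by
      refine le_trans (le_of_eq ?_) (re_le_norm _)
      simp
    rw [g_expansion_zero (re_add_im_mem_Omega hx) (by linarith)]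
    have hl := norm_log_le hx.1 hxn (by linarith)
    -- The base exceeds `1` because `π > 3`, so it is at most its square.
    have hl2 : |Real.log x| + Real.pi ≤ logSq x := by
      have := abs_nonneg (Real.log x)
      rw [logSq]
      nlinarith
    have hA := norm_tsum_mul_pow_le norm_A_le hn
    have hB := norm_tsum_mul_pow_le norm_B_le hn
    have hBl := mul_le_mul hB (hl.trans hl2) (norm_nonneg _) (by norm_num)
    refine (norm_add_le _ _).trans ?_
    rw [norm_mul]
    nlinarith [mul_nonneg hK0 h1, mul_nonneg hK0 h2]
  · have hn : ‖1 - ((x : ℂ) + y * I)‖ ≤ 3 / 4 :=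
      hsmall (a := 1 - x) (by linarith [hx.2]) (by linarith) (by simp) (by simp)
    have hxn : 1 - x ≤ ‖1 - ((x : ℂ) + y * I)‖ := by
      refine le_trans (le_of_eq ?_) (re_le_norm _)
      simp
    rw [g_expansion_one (by linarith)]
    have hl := norm_log_le (by linarith [hx.2]) hxn (by linarith)
    have hl2 : ‖log (1 - ((x : ℂ) + y * I))‖ ^ 2 ≤ logSq (1 - x) :=
      pow_le_pow_left₀ (norm_nonneg _) hl 2
    have hC := norm_tsum_mul_pow_le hK hn
    have hD := norm_tsum_mul_pow_le norm_D_le hn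
    have hDl := mul_le_mul hD hl2 (by positivity) (by norm_num)
    refine (norm_add_le _ _).trans ?_
    rw [norm_mul, norm_pow]
    nlinarith [mul_nonneg hK0 h1, mul_nonneg hK0 h2]

theorem intervalIntegrable_g_line {y : ℝ} (hy : y ∈ Icc (0 : ℝ) (1 / 2)) :
    IntervalIntegrable (fun x : ℝ => g (x + y * I)) volume 0 1 := by
  obtain ⟨M, hM⟩ := exists_norm_g_le
  have hb := intervalIntegrable_logSq_bound M
  rw [intervalIntegrable_iff_integrableOn_Ioo_of_le zero_le_one] at hb ⊢
  refine Integrable.mono' hb ?_ ((ae_restrict_iff' measurableSet_Ioo).2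
    (Eventually.of_forall fun x hx => hM x hx y hy))
  refine ContinuousOn.aestronglyMeasurable ?_ measurableSet_Ioo
  exact differentiableOn_g.continuousOn.comp (by fun_prop) fun x hx => re_add_im_mem_Omega hx

/-! ### Contour deformation -/

/-- The integrand of `J`, as a function of a complex variable. -/
noncomputable def kernel (t : ℝ) (z : ℂ) : ℂ := g z * cexp (I * z * t)

theorem norm_kernel {t : ℝ} (x y : ℝ) :
    ‖kernel t (x + y * I)‖ = ‖g (x + y * I)‖ * Real.exp (-(y * t)) := by
  rw [kernel, norm_mul, norm_exp]
  simp

theorem continuousOn_kernel (t : ℝ) : ContinuousOn (kernel t) Omega :=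
  differentiableOn_g.continuousOn.mul (by fun_prop)

/-- Cauchy's theorem is applied at height `ε`, away from the singular corners `0` and `1`; dominated
convergence then recovers `J`. -/
theorem tendsto_integral_kernel_line {t : ℝ} (ht : 0 ≤ t) :
    Tendsto (fun ε : ℝ => ∫ x in (0 : ℝ)..1, kernel t (x + ε * I)) (𝓝[>] 0) (𝓝 (J t)) := by
  obtain ⟨M, hM⟩ := exists_norm_g_le
  have hJ : J t = ∫ x in (0 : ℝ)..1, kernel t (x + (0 : ℝ) * I) := by
    simp [J, kernel]
  have hε : Ioo (0 : ℝ) (1 / 2) ∈ 𝓝[>] (0 : ℝ) := Ioo_mem_nhdsGT (by norm_num)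
  have hae : ∀ᵐ x : ℝ ∂volume, x ≠ 1 := Measure.ae_ne volume 1
  have hIoo {x : ℝ} (hx : x ∈ Set.uIoc (0 : ℝ) 1) (hx1 : x ≠ 1) : x ∈ Ioo (0 : ℝ) 1 := by
    rw [uIoc_of_le zero_le_one] at hx
    exact ⟨hx.1, lt_of_le_of_ne hx.2 hx1⟩
  rw [hJ]
  refine intervalIntegral.tendsto_integral_filter_of_dominated_convergence
    (fun x => M * (1 + logSq x + logSq (1 - x))) ?_ ?_ (intervalIntegrable_logSq_bound M) ?_
  · filter_upwards [hε] with ε hε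
    rw [uIoc_of_le zero_le_one, ← restrict_Ioo_eq_restrict_Ioc]
    exact ((continuousOn_kernel t).comp (by fun_prop)
      fun x hx => re_add_im_mem_Omega hx).aestronglyMeasurable measurableSet_Ioo
  · filter_upwards [hε] with ε hε
    filter_upwards [hae] with x hx1 hx
    rw [norm_kernel]
    refine (mul_le_of_le_one_right (norm_nonneg _) ?_).trans
      (hM x (hIoo hx hx1) ε (Ioo_subset_Icc_self hε))
    exact Real.exp_le_one_iff.2 (neg_nonpos.2 (mul_nonneg hε.1.le ht))
  · filter_upwards [hae] with x hx1 hx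
    have hmem : (x : ℂ) + (0 : ℝ) * I ∈ Omega := re_add_im_mem_Omega (hIoo hx hx1)
    have h1 : ContinuousAt (kernel t) ((x : ℂ) + (0 : ℝ) * I) :=
      (continuousOn_kernel t).continuousAt (isOpen_Omega.mem_nhds hmem)
    have h2 : Tendsto (fun ε : ℝ => (x : ℂ) + ε * I) (𝓝[>] 0) (𝓝 ((x : ℂ) + (0 : ℝ) * I)) :=
      ((by fun_prop : Continuous fun ε : ℝ => (x : ℂ) + ε * I).tendsto 0).mono_left
        nhdsWithin_le_nhds
    exact h1.tendsto.comp h2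

theorem integral_kernel_rect (t : ℝ) {ε : ℝ} (hε : ε ∈ Ioo (0 : ℝ) (1 / 2)) :
    ∫ x in (0 : ℝ)..1, kernel t (x + ε * I) =
      (∫ x in (0 : ℝ)..1, kernel t (x + (1 / 2 : ℝ) * I)) +
      I * (∫ y in ε..(1 / 2), kernel t (y * I)) -
      I * (∫ y in ε..(1 / 2), kernel t (1 + y * I)) := by
  have h := integral_boundary_rect_eq_zero_of_differentiableOn (kernel t) (ε * I)
    (1 + (1 / 2 : ℝ) * I) (fun z hz => by
      have him : z.im ∈ Set.uIcc ε (1 / 2) := by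
        have := hz.2
        simpa using this
      rw [uIcc_of_le hε.2.le] at him
      have hmem : z ∈ Omega := mem_Omega_of_im_ne_zero (hε.1.trans_le him.1).ne'
      have hd : DifferentiableAt ℂ g z := differentiableOn_g.differentiableAt
        (isOpen_Omega.mem_nhds hmem)
      exact (hd.mul (by fun_prop)).differentiableWithinAt)
  simp only [mul_re, ofReal_re, I_re, mul_zero, ofReal_im, I_im, mul_one, sub_self, add_re, one_re,
    add_zero, mul_im, add_im, one_im, zero_add, smul_eq_mul, ofReal_zero, ofReal_one] at h
  linear_combination h

theorem tendsto_integral_left_endpoint {f : ℝ → ℂ} (hf : IntervalIntegrable f volume 0 (1 / 2)) :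
    Tendsto (fun ε : ℝ => ∫ y in ε..(1 / 2), f y) (𝓝[>] 0) (𝓝 (∫ y in (0 : ℝ)..(1 / 2), f y)) := by
  have hc : ContinuousOn (fun ε => ∫ y in ε..(1 / 2), f y) (uIcc 0 (1 / 2)) := by
    refine intervalIntegral.continuousOn_primitive_interval_left ?_
    rw [uIcc_of_le (by norm_num)]
    exact (intervalIntegrable_iff_integrableOn_Icc_of_le (by norm_num)).1 hf
  have h0 := hc 0 left_mem_uIcc
  refine h0.mono_left (nhdsWithin_le_iff.2 ?_)
  rw [uIcc_of_le (by norm_num)]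
  exact Icc_mem_nhdsGT (by norm_num)

theorem J_eq_of_integrable {t : ℝ} (ht : 0 ≤ t)
    (h0 : IntervalIntegrable (fun y : ℝ => kernel t (y * I)) volume 0 (1 / 2))
    (h1 : IntervalIntegrable (fun y : ℝ => kernel t (1 + y * I)) volume 0 (1 / 2)) :
    J t = (∫ x in (0 : ℝ)..1, kernel t (x + (1 / 2 : ℝ) * I)) +
      I * (∫ y in (0 : ℝ)..(1 / 2), kernel t (y * I)) -
      I * (∫ y in (0 : ℝ)..(1 / 2), kernel t (1 + y * I)) := by
  refine tendsto_nhds_unique (tendsto_integral_kernel_line ht) ?_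
  have h := ((tendsto_const_nhds
    (x := ∫ x in (0 : ℝ)..1, kernel t (x + (1 / 2 : ℝ) * I)) (f := 𝓝[>] (0 : ℝ))).add
    ((tendsto_integral_left_endpoint h0).const_mul I)).sub
    ((tendsto_integral_left_endpoint h1).const_mul I)
  refine h.congr' ?_
  filter_upwards [Ioo_mem_nhdsGT (show (0 : ℝ) < 1 / 2 by norm_num)] with ε hε
  exact (integral_kernel_rect t hε).symm

/-! ### The three remaining sides -/

theorem exp_neg_half_isBigO (N : ℕ) :
    (fun t : ℝ => Real.exp (-(1 / 2 * t))) =O[atTop]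
      (fun t : ℝ => Real.log t ^ 2 / t ^ (N + 1)) := by
  have h := (isLittleO_exp_neg_mul_rpow_atTop (show (0 : ℝ) < 1 / 2 by norm_num)
    (-((N + 1 : ℕ) : ℝ))).isBigO
  refine (h.congr_left fun t => by rw [neg_mul]).trans (IsBigO.of_bound 1 ?_)
  filter_upwards [eventually_ge_atTop (Real.exp 1)] with t ht
  have ht0 : 0 < t := (Real.exp_pos 1).trans_le ht
  have hlt : 1 ≤ Real.log t := by
    rw [← Real.log_exp 1]
    exact Real.log_le_log (Real.exp_pos 1) ht
  rw [Real.rpow_neg ht0.le, Real.rpow_natCast, Real.norm_of_nonneg (by positivity),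
    Real.norm_of_nonneg (by positivity), one_mul, ← one_div]
  gcongr
  exact one_le_pow₀ hlt

theorem integral_kernel_top_isBigO (N : ℕ) :
    (fun t : ℝ => ∫ x in (0 : ℝ)..1, kernel t (x + (1 / 2 : ℝ) * I)) =O[atTop]
      (fun t : ℝ => Real.log t ^ 2 / t ^ (N + 1)) := by
  refine IsBigO.trans (IsBigO.of_bound (∫ x in (0 : ℝ)..1, ‖g (x + (1 / 2 : ℝ) * I)‖)
    (Eventually.of_forall fun t => ?_)) (exp_neg_half_isBigO N)
  refine (intervalIntegral.norm_integral_le_integral_norm zero_le_one).trans (le_of_eq ?_)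
  simp_rw [norm_kernel, intervalIntegral.integral_mul_const, Real.norm_eq_abs, Real.abs_exp]

/-- On `z = iy` one has `izt = -yt` and `log z = log y + πi/2`; the powers of `I` are absorbed into
the coefficients. -/
theorem kernel_left {t y : ℝ} (hy : y ∈ Ioo (0 : ℝ) (1 / 2)) :
    kernel t (y * I) = sideIntegrand (fun n => A n * I ^ n) 0 0 t y +
      sideIntegrand (fun n => B n * I ^ n) (Real.pi * I / 2) 1 t y := by
  have hn : ‖(y : ℂ) * I‖ < 1 := by
    rw [norm_mul, norm_I, mul_one, norm_real, Real.norm_of_nonneg hy.1.le]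
    linarith [hy.2]
  have hmem : (y : ℂ) * I ∈ Omega := mem_Omega_of_im_ne_zero (by simpa using hy.1.ne')
  have hlog : log ((y : ℂ) * I) = Real.log y + Real.pi * I / 2 := by
    rw [log_ofReal_mul hy.1 I_ne_zero, log_I]
    ring
  have he : I * (y * I) * t = -((y : ℂ) * t) := by
    linear_combination (y : ℂ) * t * I_mul_I
  rw [kernel, g_expansion_zero hmem hn, hlog, he]
  simp only [sideIntegrand, mul_pow, mul_assoc, mul_comm (I ^ _), pow_zero, pow_one]
  ring

/-- On `z = 1 + iy` the local variable is `1 - z = -iy`, hence the shift `-πi/2`; the factor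
`exp(it)` comes from the corner `1`. -/
theorem kernel_right {t y : ℝ} (hy : y ∈ Ioo (0 : ℝ) (1 / 2)) :
    kernel t (1 + y * I) = cexp (I * t) * (sideIntegrand (fun n => C n * (-I) ^ n) 0 0 t y +
      sideIntegrand (fun n => D n * (-I) ^ n) (-(Real.pi * I / 2)) 2 t y) := by
  have hz : 1 - (1 + (y : ℂ) * I) = y * -I := by ring
  have hn : ‖1 - (1 + (y : ℂ) * I)‖ < 1 := by
    rw [hz, norm_mul, norm_neg, norm_I, mul_one, norm_real, Real.norm_of_nonneg hy.1.le]
    linarith [hy.2]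
  have hlog : log ((y : ℂ) * -I) = Real.log y + -(Real.pi * I / 2) := by
    rw [log_ofReal_mul hy.1 (neg_ne_zero.2 I_ne_zero), log_neg_I]
    ring
  have he : I * (1 + y * I) * t = I * t + -((y : ℂ) * t) := by
    linear_combination (y : ℂ) * t * I_mul_I
  rw [kernel, g_expansion_one hn, hz, hlog, he, exp_add]
  simp only [sideIntegrand, mul_pow (y : ℂ) (-I), mul_assoc, mul_comm ((-I) ^ _), pow_zero]
  ring

theorem norm_mul_unit_pow_le {a : ℕ → ℂ} {K : ℝ} (ha : ∀ n, ‖a n‖ ≤ K) {u : ℂ} (hu : ‖u‖ = 1)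
    (n : ℕ) : ‖a n * u ^ n‖ ≤ K := by
  rw [norm_mul, norm_pow, hu, one_pow, mul_one]
  exact ha n

/-! ### Assembling the expansion -/

/-- Since `Ψ(n+1) = H_n - γ`, the bracket `γ - H_n + log t + πi/2` is minus `Ψ(n+1) - log t - πi/2`,
and the square removes the sign. -/
theorem expansionTerm_eq (n : ℕ) {t : ℝ} (ht : 0 < t) :
    expansionTerm n t =
      I * (A n * I ^ n * (∫ y : ℝ in Ioi 0,
          (y : ℂ) ^ n * ((Real.log y : ℂ) + 0) ^ 0 * cexp (-((y : ℂ) * t))) +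
        B n * I ^ n * (∫ y : ℝ in Ioi 0,
          (y : ℂ) ^ n * ((Real.log y : ℂ) + Real.pi * I / 2) ^ 1 * cexp (-((y : ℂ) * t)))) -
      I * (cexp (I * t) * (C n * (-I) ^ n * (∫ y : ℝ in Ioi 0,
          (y : ℂ) ^ n * ((Real.log y : ℂ) + 0) ^ 0 * cexp (-((y : ℂ) * t))) +
        D n * (-I) ^ n * (∫ y : ℝ in Ioi 0,
          (y : ℂ) ^ n * ((Real.log y : ℂ) + -(Real.pi * I / 2)) ^ 2 *
            cexp (-((y : ℂ) * t))))) := by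
  rw [laplace_zero n 0 ht, laplace_one n _ ht, laplace_two n _ ht, expansionTerm,
    digamma_nat_add_one]
  ring

theorem J_expansion (N : ℕ) :
    (fun t : ℝ => J t - ∑ n ∈ Finset.range N, expansionTerm n t)
      =O[atTop] (fun t : ℝ => Real.log t ^ 2 / t ^ (N + 1)) := by
  obtain ⟨K, hK⟩ := exists_norm_C_le
  have hnI : ‖-I‖ = 1 := by rw [norm_neg, norm_I]
  obtain ⟨iA, oA⟩ := watson (norm_mul_unit_pow_le norm_A_le norm_I) 0 (k := 0) (by norm_num) N
  obtain ⟨iB, oB⟩ := watson (norm_mul_unit_pow_le norm_B_le norm_I) (Real.pi * I / 2) (k := 1)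
    (by norm_num) N
  obtain ⟨iC, oC⟩ := watson (norm_mul_unit_pow_le hK hnI) 0 (k := 0) (by norm_num) N
  obtain ⟨iD, oD⟩ := watson (norm_mul_unit_pow_le norm_D_le hnI) (-(Real.pi * I / 2)) (k := 2)
    le_rfl N
  have hexp : (fun t : ℝ => cexp (I * t)) =O[atTop] (fun _ : ℝ => (1 : ℝ)) := by
    refine IsBigO.of_bound 1 (Eventually.of_forall fun t => ?_)
    rw [mul_comm, norm_exp_ofReal_mul_I]
    simp
  have oCD := hexp.mul (oC.add oD)
  simp only [one_mul] at oCD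
  refine (((integral_kernel_top_isBigO N).add ((oA.add oB).const_mul_left I)).sub
    (oCD.const_mul_left I)).congr' ?_ EventuallyEq.rfl
  filter_upwards [eventually_ge_atTop (Real.exp 1)] with t ht
  have ht0 : 0 < t := (Real.exp_pos 1).trans_le ht
  -- The side formulas are available only for `0 < y < 1/2`; the endpoints form a null set.
  have congrInt {f₁ f₂ : ℝ → ℂ} (h : ∀ y ∈ Ioo (0 : ℝ) (1 / 2), f₁ y = f₂ y)
      (hi : IntervalIntegrable f₂ volume 0 (1 / 2)) :
      IntervalIntegrable f₁ volume 0 (1 / 2) ∧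
        ∫ y in (0 : ℝ)..(1 / 2), f₁ y = ∫ y in (0 : ℝ)..(1 / 2), f₂ y := by
    have hh : (0 : ℝ) ≤ 1 / 2 := by norm_num
    rw [intervalIntegrable_iff_integrableOn_Ioo_of_le hh] at hi ⊢
    refine ⟨hi.congr_fun (fun y hy => (h y hy).symm) measurableSet_Ioo, ?_⟩
    rw [intervalIntegral.integral_of_le hh, intervalIntegral.integral_of_le hh,
      integral_Ioc_eq_integral_Ioo, integral_Ioc_eq_integral_Ioo]
    exact setIntegral_congr_fun measurableSet_Ioo h
  obtain ⟨hl, hlEq⟩ := congrInt (fun y hy => kernel_left (t := t) hy) ((iA t ht).add (iB t ht))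
  obtain ⟨hr, hrEq⟩ := congrInt (fun y hy => kernel_right (t := t) hy)
    (((iC t ht).add (iD t ht)).const_mul (cexp (I * t)))
  rw [intervalIntegral.integral_const_mul] at hrEq
  have hlEq' := hlEq.trans (intervalIntegral.integral_add (iA t ht) (iB t ht))
  have hrEq' := hrEq.trans (congrArg (cexp (I * t) * ·)
    (intervalIntegral.integral_add (iC t ht) (iD t ht)))
  rw [J_eq_of_integrable ht0.le hl hr, hlEq', hrEq',
    Finset.sum_congr rfl fun n _ => expansionTerm_eq n ht0]
  simp only [Finset.sum_sub_distrib, ← Finset.mul_sum, Finset.sum_add_distrib]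
  ring

end LogFourier

theorem mainTheorem4 :
    -- `g` is integrable on `(0, 1)`, so that `J` is a genuine integral
    IntervalIntegrable (fun x : ℝ => LogFourier.g (x : ℂ)) volume 0 1 ∧
    -- `A_n`, `B_n` are the coefficients of the local expansion of `g` at `0`
    (∀ z ∈ LogFourier.Omega, ‖z‖ < 1 →
      Summable (fun n : ℕ => LogFourier.A n * z ^ n) ∧
      Summable (fun n : ℕ => LogFourier.B n * z ^ n) ∧
      LogFourier.g z =
        (∑' n : ℕ, LogFourier.A n * z ^ n) + (∑' n : ℕ, LogFourier.B n * z ^ n) * Complex.log z) ∧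
    -- `C_n`, `D_n` are the coefficients of the local expansion of `g` at `1`
    (∀ z ∈ LogFourier.Omega, ‖1 - z‖ < 1 →
      Summable (fun n : ℕ => LogFourier.C n * (1 - z) ^ n) ∧
      Summable (fun n : ℕ => LogFourier.D n * (1 - z) ^ n) ∧
      LogFourier.g z =
        (∑' n : ℕ, LogFourier.C n * (1 - z) ^ n) +
          (∑' n : ℕ, LogFourier.D n * (1 - z) ^ n) * Complex.log (1 - z) ^ 2) ∧
    -- the asymptotic expansion: the error after the terms `n < N` has the order of the first
    -- omitted terms
    (∀ N : ℕ,
      (fun t : ℝ => LogFourier.J t - ∑ n ∈ Finset.range N, LogFourier.expansionTerm n t)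
        =O[atTop] (fun t : ℝ => Real.log t ^ 2 / t ^ (N + 1))) := by
  refine ⟨?_, fun z hz hz1 => ?_, fun z _ hz1 => ?_, LogFourier.J_expansion⟩
  · simpa using LogFourier.intervalIntegrable_g_line (y := 0) (by norm_num)
  · exact ⟨(LogFourier.summable_norm_mul_pow LogFourier.norm_A_le hz1).of_norm,
      (LogFourier.summable_norm_mul_pow LogFourier.norm_B_le hz1).of_norm,
      LogFourier.g_expansion_zero hz hz1⟩
  · exact ⟨(LogFourier.hasSum_C hz1).summable, (LogFourier.hasSum_D hz1).summable,
      LogFourier.g_expansion_one hz1⟩
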